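/- Let $G$ be a separable (that is, second countable) locally compact Hausdorff group, let $(X,m)$ be a $\sigma$-finite measure space, and let $G\curvearrowright X$ be a measurable action (the map $G\times X\to X$, $(g,x)\mapsto gx$, is measurable) such that $m$ is quasi-invariant: for every $g\in G$, $m$ and its image $gm$ under $x\mapsto gx$ have the same null sets. Let $\pi_X$ be the Koopman representation of $G$ on the whole space $L^2(X,m)$ of complex-valued functions (also when $m$ is a $G$-invariant probability measure), given by $$(\pi_X(g)f)(x)=\Big(\frac{d(gm)}{dm}(x)\Big)^{1/2}f(g^{-1}x),$$ a strongly continuous unitary representation. For a probability measure $\mu$ on the Borel subsets of $G$, let $\pi_X(\mu)f=\int_G\pi_X(g)f\,d\mu(g)$, a bounded operator on $L^2(X,m)$, and let $r_{\rm spec}$ denote the spectral radius (the norm and the spectral radius of the operator on the zero space are $0$). The measure $\mu$ is called adapted if the subgroup generated by ${\rm supp}(\mu)$ is dense in $G$, and strongly adapted if ${\rm supp}(\mu)$ is not contained in a coset of a proper closed subgroup of $G$. The following properties are equivalent: (i) the action is co-amenable: there is a positive linear functional $M$ on $L^\infty(X,m)$ with $M(\mathbf 1_X)=1$ and $M({}_g\varphi)=M(\varphi)$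 for all $g\in G$ and $\varphi\in L^\infty(X,m)$, where ${}_g\varphi(x)=\varphi(g^{-1}x)$; (ii) $\pi_X$ does not have the Spectral Gap Property, that is, there are no compact set $Q\subset G$ and $\varepsilon>0$ such that $\sup_{s\in Q}\Vert\pi_X(s)f-f\Vert\ge\varepsilon\Vert f\Vert$ for all $f\in L^2(X,m)$; (iii) $r_{\rm spec}(\pi_X(\mu))=1$ for every probability measure $\mu$ on $G$; (iv) $\Vert\pi_X(\mu)\Vert=1$ for some strongly adapted probability measure $\mu$ on $G$; (v) $r_{\rm spec}(\pi_X(\mu))=1$ for some adapted probability measure $\mu$ on $G$. -/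

import Mathlib

open MeasureTheory Filter Topology
open scoped ENNReal

namespace CoamenableAction

/-- The measure `m` and its image `g m` under `x ↦ g x` have the same null sets, for all `g`. -/
class QuasiInvariant (G : Type*) {X : Type*} [SMul G X] [MeasurableSpace X]
    (m : Measure X) : Prop where
  map_ac : ∀ g : G, m.map (fun x => g • x) ≪ m
  ac_map : ∀ g : G, m ≪ m.map (fun x => g • x)

/-- The Radon–Nikodym derivative `d(g m)/dm`, that is, `dm(g⁻¹ x)/dm(x)`. -/
noncomputable def density {G X : Type*} [SMul G X] [MeasurableSpace X] (m : Measure X)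
    (g : G) (x : X) : ℝ≥0∞ :=
  (m.map (fun x => g • x)).rnDeriv m x

/-- `x ↦ (dm(g⁻¹ x)/dm(x))^(1/2) f(g⁻¹ x)`. -/
noncomputable def koopmanFun {G X : Type*} [Group G] [MulAction G X] [MeasurableSpace X]
    (m : Measure X) (g : G) (f : X → ℂ) (x : X) : ℂ :=
  (Real.sqrt (density m g x).toReal : ℂ) * f (g⁻¹ • x)

set_option linter.unusedSectionVars false

section Koopman

variable {G X : Type*} [Group G] [MeasurableSpace G] [MulAction G X] [MeasurableSpace X]
  [MeasurableSMul₂ G X] (m : Measure X) [SigmaFinite m] [QuasiInvariant G m]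

theorem measurable_density (g : G) : Measurable (density m g) :=
  Measure.measurable_rnDeriv _ _

theorem quasiMeasurePreserving_smul (g : G) :
    Measure.QuasiMeasurePreserving (fun x : X => g • x) m m :=
  ⟨measurable_const_smul g, QuasiInvariant.map_ac g⟩

theorem sigmaFinite_map_smul (g : G) : SigmaFinite (m.map (fun x => g • x)) :=
  (MeasurableEquiv.smul g).sigmaFinite_map

theorem density_lt_top (g : G) : ∀ᵐ x ∂m, density m g x < ∞ :=
  haveI := sigmaFinite_map_smul m g
  Measure.rnDeriv_lt_top _ _

theorem withDensity_density (g : G) :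
    m.withDensity (density m g) = m.map (fun x => g • x) :=
  Measure.withDensity_rnDeriv_eq _ _ (QuasiInvariant.map_ac g)

theorem lintegral_density (g : G) {φ : X → ℝ≥0∞} (hφ : AEMeasurable φ m) :
    ∫⁻ x, density m g x * φ (g⁻¹ • x) ∂m = ∫⁻ x, φ x ∂m := by
  have h1 : AEMeasurable (fun x => φ (g⁻¹ • x)) m :=
    hφ.comp_quasiMeasurePreserving (quasiMeasurePreserving_smul m g⁻¹)
  have h2 : AEMeasurable (fun x => φ (g⁻¹ • x)) (m.map (fun x => g • x)) :=
    h1.mono_ac (QuasiInvariant.map_ac g)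
  unfold density
  rw [lintegral_rnDeriv_mul (QuasiInvariant.map_ac g) h1,
    lintegral_map' h2 (measurable_const_smul g).aemeasurable]
  simp

theorem rnDeriv_map_smul (g : G) {ν : Measure X} [SFinite ν] (hν : ν ≪ m) :
    ∀ᵐ x ∂m, (ν.map (fun x => g • x)).rnDeriv m x = density m g x * ν.rnDeriv m (g⁻¹ • x) := by
  have hd : Measurable (ν.rnDeriv m) := Measure.measurable_rnDeriv _ _
  have hmeas : Measurable (fun x => density m g x * ν.rnDeriv m (g⁻¹ • x)) :=
    (measurable_density m g).mul (hd.comp (measurable_const_smul g⁻¹))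
  have key : ν.map (fun x => g • x)
      = m.withDensity (fun x => density m g x * ν.rnDeriv m (g⁻¹ • x)) := by
    ext s hs
    have hgs : MeasurableSet ((fun x : X => g • x) ⁻¹' s) := measurable_const_smul g hs
    rw [Measure.map_apply (measurable_const_smul _) hs, withDensity_apply _ hs,
      ← Measure.setLIntegral_rnDeriv' hν hgs,
      ← lintegral_indicator hs, ← lintegral_indicator hgs,
      ← lintegral_density m g ((hd.indicator hgs).aemeasurable)]
    refine lintegral_congr fun x => ?_
    by_cases hx : x ∈ s
    · simp [Set.indicator, hx]
    · simp [Set.indicator, hx]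
  have := Measure.rnDeriv_withDensity m hmeas
  rw [← key] at this
  exact this

theorem density_mul (g h : G) :
    ∀ᵐ x ∂m, density m (g * h) x = density m g x * density m h (g⁻¹ • x) := by
  have h1 := rnDeriv_map_smul m g (QuasiInvariant.map_ac (m := m) h)
  rw [Measure.map_map (measurable_const_smul _) (measurable_const_smul _)] at h1
  have e : (fun x : X => g • x) ∘ (fun x => h • x) = fun x => (g * h) • x := by
    ext x; simp [mul_smul]
  rw [e] at h1
  exact h1

theorem density_one : ∀ᵐ x ∂m, density m (1 : G) x = 1 := by
  have h := Measure.rnDeriv_self m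
  have e : (fun x : X => (1 : G) • x) = id := by ext x; simp
  unfold density
  rw [e, Measure.map_id]
  exact h

theorem enorm_sqrt_sq {c : ℝ≥0∞} (hc : c < ∞) :
    ‖((Real.sqrt c.toReal : ℝ) : ℂ)‖ₑ ^ (2 : ℝ) = c := by
  rw [← ofReal_norm, Complex.norm_real, Real.norm_of_nonneg (Real.sqrt_nonneg _),
    ENNReal.ofReal_rpow_of_nonneg (Real.sqrt_nonneg _) (by norm_num)]
  norm_num [Real.sq_sqrt ENNReal.toReal_nonneg, ENNReal.ofReal_toReal hc.ne]

theorem aestronglyMeasurable_koopmanFun (g : G) {f : X → ℂ} (hf : AEStronglyMeasurable f m) :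
    AEStronglyMeasurable (koopmanFun m g f) m := by
  refine AEStronglyMeasurable.mul ?_
    (hf.comp_quasiMeasurePreserving (quasiMeasurePreserving_smul m g⁻¹))
  have : Measurable fun x => ((Real.sqrt (density m g x).toReal : ℝ) : ℂ) :=
    Complex.measurable_ofReal.comp (measurable_density m g).ennreal_toReal.sqrt
  exact this.aestronglyMeasurable

theorem eLpNorm_koopmanFun (g : G) {f : X → ℂ} (hf : AEStronglyMeasurable f m) :
    eLpNorm (koopmanFun m g f) 2 m = eLpNorm f 2 m := by
  rw [eLpNorm_eq_lintegral_rpow_enorm_toReal (by norm_num) (by norm_num),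
    eLpNorm_eq_lintegral_rpow_enorm_toReal (by norm_num) (by norm_num)]
  congr 1
  rw [← lintegral_density m g (hf.enorm.pow_const _)]
  refine lintegral_congr_ae ?_
  filter_upwards [density_lt_top m g] with x hx
  simp only [koopmanFun, enorm_mul, ENNReal.toReal_ofNat]
  rw [ENNReal.mul_rpow_of_nonneg _ _ (by norm_num), enorm_sqrt_sq hx]

theorem memLp_koopmanFun (g : G) (f : Lp ℂ 2 m) : MemLp (koopmanFun m g f) 2 m :=
  ⟨aestronglyMeasurable_koopmanFun m g (Lp.aestronglyMeasurable f), by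
    rw [eLpNorm_koopmanFun m g (Lp.aestronglyMeasurable f)]; exact Lp.eLpNorm_lt_top f⟩

theorem ae_smul {p : X → Prop} (g : G) (h : ∀ᵐ x ∂m, p x) : ∀ᵐ x ∂m, p (g • x) :=
  (quasiMeasurePreserving_smul m g).ae h

/-- The isometry `π_X(g)` of `L²(X, m)`. -/
noncomputable def koopmanIsometry (g : G) : Lp ℂ 2 m →ₗᵢ[ℂ] Lp ℂ 2 m where
  toFun f := (memLp_koopmanFun m g f).toLp
  map_add' f f' := by
    ext1
    filter_upwards [(memLp_koopmanFun m g (f + f')).coeFn_toLp,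
      (memLp_koopmanFun m g f).coeFn_toLp, (memLp_koopmanFun m g f').coeFn_toLp,
      Lp.coeFn_add (memLp_koopmanFun m g f).toLp (memLp_koopmanFun m g f').toLp,
      ae_smul m g⁻¹ (Lp.coeFn_add f f')] with x h1 h2 h3 h4 h5
    simp only [h1, h2, h3, h4, h5, koopmanFun, Pi.add_apply, mul_add]
  map_smul' a f := by
    ext1
    filter_upwards [(memLp_koopmanFun m g (a • f)).coeFn_toLp,
      (memLp_koopmanFun m g f).coeFn_toLp, Lp.coeFn_smul a (memLp_koopmanFun m g f).toLp,
      ae_smul m g⁻¹ (Lp.coeFn_smul a f)] with x h1 h2 h3 h4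
    simp only [h1, h2, h3, h4, koopmanFun, Pi.smul_apply, smul_eq_mul, RingHom.id_apply]
    ring
  norm_map' f := by
    simp only [LinearMap.coe_mk, AddHom.coe_mk, Lp.norm_toLp]
    rw [eLpNorm_koopmanFun m g (Lp.aestronglyMeasurable f)]
    rfl

theorem koopmanIsometry_ae (g : G) (f : Lp ℂ 2 m) :
    koopmanIsometry m g f =ᵐ[m] koopmanFun m g f :=
  (memLp_koopmanFun m g f).coeFn_toLp

theorem koopmanIsometry_one (f : Lp ℂ 2 m) : koopmanIsometry m (1 : G) f = f := by
  ext1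
  filter_upwards [koopmanIsometry_ae m (1 : G) f, density_one (G := G) m] with x h1 h2
  simp [h1, koopmanFun, h2]

theorem koopmanIsometry_mul (g h : G) (f : Lp ℂ 2 m) :
    koopmanIsometry m (g * h) f = koopmanIsometry m g (koopmanIsometry m h f) := by
  ext1
  filter_upwards [koopmanIsometry_ae m (g * h) f,
    koopmanIsometry_ae m g (koopmanIsometry m h f),
    ae_smul m g⁻¹ (koopmanIsometry_ae m h f), density_mul m g h] with x h1 h2 h3 h4
  rw [h1, h2]
  simp only [koopmanFun, h3, h4, ENNReal.toReal_mul, Real.sqrt_mul ENNReal.toReal_nonneg,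
    mul_inv_rev, mul_smul, Complex.ofReal_mul]
  ring

/-- The unitary operators `π_X(g)` form a group homomorphism. -/
noncomputable def koopmanHom : G →* (Lp ℂ 2 m ≃ₗᵢ[ℂ] Lp ℂ 2 m) where
  toFun g :=
    { toLinearEquiv := LinearEquiv.ofLinearMap (koopmanIsometry m g).toLinearMap
        (koopmanIsometry m g⁻¹).toLinearMap
        (by ext1 f; simp [← koopmanIsometry_mul, koopmanIsometry_one])
        (by ext1 f; simp [← koopmanIsometry_mul, koopmanIsometry_one])
      norm_map' := fun f => (koopmanIsometry m g).norm_map f }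
  map_one' := by
    ext1 f
    exact koopmanIsometry_one m f
  map_mul' g h := by
    ext1 f
    exact koopmanIsometry_mul m g h f

end Koopman

section Continuity

open Measure

variable {G X : Type*} [Group G] [TopologicalSpace G] [IsTopologicalGroup G]
  [LocallyCompactSpace G] [SecondCountableTopology G] [T2Space G]
  [MeasurableSpace G] [BorelSpace G] [MulAction G X] [MeasurableSpace X]
  [MeasurableSMul₂ G X] (m : Measure X) [SigmaFinite m] [QuasiInvariant G m]

/-- The average over `h ∈ B` of the translates by `h` of a finite measure equivalent to `m`. -/
noncomputable def smear (B : Set G) : Measure X :=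
  ((haar.restrict B).prod m.toFinite).map (fun p : G × X => p.1 • p.2)

/-- The translate `g B`. -/
def shift (g : G) (B : Set G) : Set G := (fun h => g⁻¹ * h) ⁻¹' B

theorem measurableSet_shift (g : G) {B : Set G} (hB : MeasurableSet B) :
    MeasurableSet (shift g B) := measurable_const_mul g⁻¹ hB

theorem haar_shift (g : G) (B : Set G) : (haar : Measure G) (shift g B) = haar B :=
  measure_preimage_mul _ _ _

theorem smear_apply (B : Set G) {A : Set X} (hA : MeasurableSet A) :
    smear m B A = ∫⁻ h in B, m.toFinite ((fun x => h • x) ⁻¹' A) ∂haar := by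
  unfold smear
  have hm : Measurable fun p : G × X => p.1 • p.2 := measurable_smul
  rw [map_apply hm hA, prod_apply (hm hA)]
  rfl

theorem measurable_smear_aux {A : Set X} (hA : MeasurableSet A) :
    Measurable fun h : G => m.toFinite ((fun x => h • x) ⁻¹' A) :=
  measurable_measure_prodMk_left (measurable_smul (M := G) hA)

theorem smear_univ (B : Set G) : smear m B Set.univ = m.toFinite Set.univ * haar B := by
  rw [smear_apply m B MeasurableSet.univ]
  simp

theorem isFiniteMeasure_smear {B : Set G} (hB : haar B ≠ ∞) : IsFiniteMeasure (smear m B) :=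
  ⟨by rw [smear_univ]; exact ENNReal.mul_lt_top (measure_lt_top _ _) hB.lt_top⟩

theorem toFinite_preimage_eq_zero {A : Set X} (hA : MeasurableSet A) (g : G) :
    m.toFinite ((fun x => g • x) ⁻¹' A) = 0 ↔ m A = 0 := by
  rw [(show m.toFinite ((fun x => g • x) ⁻¹' A) = 0 ↔ m ((fun x => g • x) ⁻¹' A) = 0 from
    ⟨fun h => absolutelyContinuous_toFinite m h, fun h => toFinite_absolutelyContinuous m h⟩),
    ← map_apply (measurable_const_smul g) hA]
  exact ⟨fun h => QuasiInvariant.ac_map g h, fun h => QuasiInvariant.map_ac g h⟩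

theorem smear_ac (B : Set G) : smear m B ≪ m := by
  refine AbsolutelyContinuous.mk fun A hA h0 => ?_
  rw [smear_apply m B hA]
  simp [(toFinite_preimage_eq_zero m hA _).2 h0]

theorem ac_smear {B : Set G} (hB : haar B ≠ 0) : m ≪ smear m B := by
  refine AbsolutelyContinuous.mk fun A hA h0 => ?_
  rw [smear_apply m B hA, lintegral_eq_zero_iff (measurable_smear_aux m hA)] at h0
  have : NeZero ((haar : Measure G).restrict B) := ⟨by simpa using hB⟩
  obtain ⟨h, hh⟩ := h0.exists
  exact (toFinite_preimage_eq_zero m hA h).1 hh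

theorem map_smear (g : G) {B : Set G} (hB : MeasurableSet B) :
    (smear m B).map (fun x => g • x) = smear m (shift g B) := by
  ext A hA
  rw [map_apply (measurable_const_smul g) hA, smear_apply m _ hA,
    smear_apply m B (measurable_const_smul g hA), ← lintegral_indicator hB,
    ← lintegral_indicator (measurableSet_shift g hB), ← lintegral_mul_left_eq_self ((shift g B).indicator _) g]
  refine lintegral_congr fun h => ?_
  have e : (fun x : X => h • x) ⁻¹' ((fun x : X => g • x) ⁻¹' A)
      = (fun x : X => (g * h) • x) ⁻¹' A := by
    ext x; simp [mul_smul]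
  by_cases hh : h ∈ B
  · rw [Set.indicator_of_mem hh, Set.indicator_of_mem (by simpa [shift] using hh), e]
  · rw [Set.indicator_of_notMem hh, Set.indicator_of_notMem (by simpa [shift] using hh)]

theorem rnDeriv_smear_le {B B' : Set G} (hB : haar B ≠ ∞) (hB' : haar B' ≠ ∞) :
    ∀ᵐ x ∂m, (smear m B').rnDeriv m x
      ≤ (smear m B).rnDeriv m x + (smear m (symmDiff B' B)).rnDeriv m x := by
  have i1 := isFiniteMeasure_smear m hB
  have i2 := isFiniteMeasure_smear m hB'
  have i3 := isFiniteMeasure_smear m (measure_symmDiff_ne_top hB' hB)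
  refine ae_le_of_forall_setLIntegral_le_of_sigmaFinite (measurable_rnDeriv _ _) fun s hs _ => ?_
  rw [lintegral_add_left (measurable_rnDeriv _ _), setLIntegral_rnDeriv' (smear_ac m _) hs,
    setLIntegral_rnDeriv' (smear_ac m _) hs, setLIntegral_rnDeriv' (smear_ac m _) hs,
    smear_apply m _ hs, smear_apply m _ hs, smear_apply m _ hs]
  refine (lintegral_mono_set ?_).trans (lintegral_union_le _ B (symmDiff B' B))
  intro h hh
  by_cases h2 : h ∈ B
  · exact Or.inl h2
  · exact Or.inr (Or.inl ⟨hh, h2⟩)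

/-- The square root of the density of `smear m B`. -/
noncomputable def rootFun (B : Set G) (x : X) : ℂ :=
  (Real.sqrt ((smear m B).rnDeriv m x).toReal : ℂ)

theorem measurable_rootFun (B : Set G) : Measurable (rootFun m B) :=
  Complex.measurable_ofReal.comp (measurable_rnDeriv _ _).ennreal_toReal.sqrt

theorem memLp_rootFun {B : Set G} (hB : haar B ≠ ∞) : MemLp (rootFun m B) 2 m := by
  have i1 := isFiniteMeasure_smear m hB
  refine ⟨(measurable_rootFun m B).aestronglyMeasurable, ?_⟩
  rw [eLpNorm_eq_lintegral_rpow_enorm_toReal (by norm_num) (by norm_num)]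
  refine ENNReal.rpow_lt_top_of_nonneg (by norm_num) (ne_of_lt ?_)
  calc ∫⁻ x, ‖rootFun m B x‖ₑ ^ (2 : ℝ≥0∞).toReal ∂m
      = ∫⁻ x, (smear m B).rnDeriv m x ∂m := by
        refine lintegral_congr_ae ?_
        filter_upwards [rnDeriv_lt_top (smear m B) m] with x hx
        rw [ENNReal.toReal_ofNat]
        exact enorm_sqrt_sq hx
    _ ≤ smear m B Set.univ := lintegral_rnDeriv_le
    _ < ∞ := measure_lt_top _ _

theorem koopmanFun_rootFun (g : G) {B : Set G} (hBm : MeasurableSet B) (hB : haar B ≠ ∞) :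
    ∀ᵐ x ∂m, koopmanFun m g (rootFun m B) x = rootFun m (shift g B) x := by
  have i1 := isFiniteMeasure_smear m hB
  have h := rnDeriv_map_smul m g (smear_ac m B)
  rw [map_smear m g hBm] at h
  filter_upwards [h] with x hx
  simp only [koopmanFun, rootFun, hx, ENNReal.toReal_mul, Real.sqrt_mul ENNReal.toReal_nonneg,
    Complex.ofReal_mul]

theorem sq_sqrt_sub_le {p q r : ℝ} (hp : 0 ≤ p) (hq : 0 ≤ q) (h1 : p ≤ q + r) (h2 : q ≤ p + r) :
    (Real.sqrt p - Real.sqrt q) ^ 2 ≤ r := by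
  have a := Real.sqrt_nonneg p
  have b := Real.sqrt_nonneg q
  have a2 := Real.sq_sqrt hp
  have b2 := Real.sq_sqrt hq
  rcases le_total (Real.sqrt p) (Real.sqrt q) with h | h <;> nlinarith

theorem eLpNorm_rootFun_sub {B B' : Set G} (hB : haar B ≠ ∞) (hB' : haar B' ≠ ∞) :
    eLpNorm (fun x => rootFun m B' x - rootFun m B x) 2 m
      ≤ (m.toFinite Set.univ * haar (symmDiff B' B)) ^ (1 / 2 : ℝ) := by
  have i1 := isFiniteMeasure_smear m hB
  have i2 := isFiniteMeasure_smear m hB'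
  have i3 := isFiniteMeasure_smear m (measure_symmDiff_ne_top hB' hB)
  rw [eLpNorm_eq_lintegral_rpow_enorm_toReal (by norm_num) (by norm_num)]
  simp only [ENNReal.toReal_ofNat]
  refine ENNReal.rpow_le_rpow ?_ (by norm_num)
  rw [← smear_univ]
  refine le_trans (lintegral_mono_ae ?_) (lintegral_rnDeriv_le (ν := m))
  have h2 := rnDeriv_smear_le m hB' hB
  rw [symmDiff_comm] at h2
  filter_upwards [rnDeriv_lt_top (smear m B) m, rnDeriv_lt_top (smear m B') m,
    rnDeriv_lt_top (smear m (symmDiff B' B)) m, rnDeriv_smear_le m hB hB', h2]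
    with x f1 f2 f3 l1 l2
  simp only [rootFun]
  rw [← Complex.ofReal_sub, ← ofReal_norm, Complex.norm_real,
    ENNReal.ofReal_rpow_of_nonneg (norm_nonneg _) (by norm_num)]
  refine ENNReal.ofReal_le_of_le_toReal ?_
  rw [Real.rpow_two, Real.norm_eq_abs, sq_abs]
  refine sq_sqrt_sub_le ENNReal.toReal_nonneg ENNReal.toReal_nonneg ?_ ?_
  · rw [← ENNReal.toReal_add f1.ne f3.ne]
    exact ENNReal.toReal_mono (ENNReal.add_lt_top.2 ⟨f1, f3⟩).ne l1
  · rw [← ENNReal.toReal_add f2.ne f3.ne]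
    exact ENNReal.toReal_mono (ENNReal.add_lt_top.2 ⟨f2, f3⟩).ne l2

/-- `x ↦ λ {h ∈ B | h⁻¹ x ∈ C}` for a Haar measure `λ`. -/
noncomputable def countFun (B : Set G) (C : Set X) (x : X) : ℝ :=
  (haar : Measure G).real {h | h ∈ B ∧ h⁻¹ • x ∈ C}

theorem measurableSet_countFun {B : Set G} (hB : MeasurableSet B) {C : Set X}
    (hC : MeasurableSet C) (x : X) : MeasurableSet {h : G | h ∈ B ∧ h⁻¹ • x ∈ C} :=
  hB.inter ((measurable_inv.smul_const x) hC)

theorem measurable_countFun {B : Set G} (hB : MeasurableSet B) {C : Set X}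
    (hC : MeasurableSet C) : Measurable (countFun (X := X) B C) := by
  have hS : MeasurableSet {p : X × G | p.2 ∈ B ∧ p.2⁻¹ • p.1 ∈ C} :=
    (measurable_snd hB).inter ((measurable_snd.inv.smul measurable_fst) hC)
  exact (measurable_measure_prodMk_left hS).ennreal_toReal

theorem countFun_nonneg (B : Set G) (C : Set X) (x : X) : 0 ≤ countFun B C x := measureReal_nonneg

theorem countFun_le {B : Set G} (hB : haar B ≠ ∞) (C : Set X) (x : X) :
    countFun B C x ≤ (haar : Measure G).real B :=
  measureReal_mono (fun _ h => h.1) hB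

theorem countFun_smul (g : G) (B : Set G) (C : Set X) (x : X) :
    countFun B C (g⁻¹ • x) = countFun (shift g B) C x := by
  unfold countFun
  rw [measureReal_def, measureReal_def, ← haar_shift g {h | h ∈ B ∧ h⁻¹ • g⁻¹ • x ∈ C}]
  congr 2
  ext h
  simp [shift, smul_smul]

theorem abs_countFun_sub_le {B B' : Set G} (hBm : MeasurableSet B) (hBm' : MeasurableSet B')
    (hB : haar B ≠ ∞) (hB' : haar B' ≠ ∞) {C : Set X} (hC : MeasurableSet C) (x : X) :
    |countFun B' C x - countFun B C x| ≤ (haar : Measure G).real (symmDiff B' B) := by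
  unfold countFun
  have h1 : (haar : Measure G) {h | h ∈ B ∧ h⁻¹ • x ∈ C} ≠ ∞ :=
    ne_top_of_le_ne_top hB (measure_mono fun _ h => h.1)
  have h1' : (haar : Measure G) {h | h ∈ B' ∧ h⁻¹ • x ∈ C} ≠ ∞ :=
    ne_top_of_le_ne_top hB' (measure_mono fun _ h => h.1)
  refine (abs_measureReal_sub_le_measureReal_symmDiff'
    (measurableSet_countFun hBm' hC x).nullMeasurableSet
    (measurableSet_countFun hBm hC x).nullMeasurableSet h1' h1).trans ?_
  refine measureReal_mono ?_ (measure_symmDiff_ne_top hB' hB)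
  rintro h (⟨⟨h1, h2⟩, h3⟩ | ⟨⟨h1, h2⟩, h3⟩)
  · exact Or.inl ⟨h1, fun h4 => h3 ⟨h4, h2⟩⟩
  · exact Or.inr ⟨h1, fun h4 => h3 ⟨h4, h2⟩⟩

theorem tendsto_haar_shift {B : Set G} (hBm : MeasurableSet B) (hB : haar B ≠ ∞) :
    Tendsto (fun g : G => (haar : Measure G) (symmDiff (shift g B) B)) (𝓝 1) (𝓝 0) := by
  let F : C(G, C(G, G)) := ContinuousMap.curry
    ⟨fun p : G × G => p.1⁻¹ * p.2, by fun_prop⟩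
  have hF : Tendsto F (𝓝 1) (𝓝 (F 1)) := F.continuous.tendsto 1
  have h := tendsto_measure_symmDiff_preimage_nhds_zero (μ := (haar : Measure G))
    (ν := (haar : Measure G)) hF
    (Eventually.of_forall fun g => measurePreserving_mul_left haar g⁻¹)
    (measurePreserving_mul_left haar (1 : G)⁻¹) hBm.nullMeasurableSet hB
  have e : (F 1) ⁻¹' B = B := by ext; simp [F]
  rw [e] at h
  exact h

/-- The function `countFun B C · rootFun K`. -/
noncomputable def testFun (B : Set G) (C : Set X) (K : Set G) (x : X) : ℂ :=
  (countFun B C x : ℂ) * rootFun m K x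

theorem memLp_testFun {B : Set G} (hBm : MeasurableSet B) (hB : haar B ≠ ∞) {C : Set X}
    (hC : MeasurableSet C) {K : Set G} (hK : haar K ≠ ∞) : MemLp (testFun m B C K) 2 m := by
  refine MemLp.of_le_mul (c := (haar : Measure G).real B) (memLp_rootFun m hK) ?_ ?_
  · exact ((Complex.measurable_ofReal.comp (measurable_countFun hBm hC)).mul
      (measurable_rootFun m K)).aestronglyMeasurable
  · refine Eventually.of_forall fun x => ?_
    rw [testFun, norm_mul, Complex.norm_real, Real.norm_of_nonneg (countFun_nonneg _ _ _)]
    gcongr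
    exact countFun_le hB C x

theorem eLpNorm_testFun_sub {B B' K K' : Set G} (hBm : MeasurableSet B)
    (hBm' : MeasurableSet B') (hB : haar B ≠ ∞) (hB' : haar B' ≠ ∞) {C : Set X}
    (hC : MeasurableSet C) (hK : haar K ≠ ∞) (hK' : haar K' ≠ ∞) :
    eLpNorm (fun x => testFun m B' C K' x - testFun m B C K x) 2 m
      ≤ haar (symmDiff B' B) * eLpNorm (rootFun m K) 2 m
        + haar B' * (m.toFinite Set.univ * haar (symmDiff K' K)) ^ (1 / 2 : ℝ) := by
  have e : (fun x => testFun m B' C K' x - testFun m B C K x)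
      = (fun x => ((countFun B' C x - countFun B C x : ℝ) : ℂ) * rootFun m K x)
        + fun x => (countFun B' C x : ℂ) * (rootFun m K' x - rootFun m K x) := by
    ext x
    simp only [testFun, Pi.add_apply]
    push_cast
    ring
  have hm1 := (measurable_rootFun m K)
  have hm2 := (measurable_rootFun m K')
  have hc := measurable_countFun hBm hC
  have hc' := measurable_countFun hBm' hC
  rw [e]
  refine (eLpNorm_add_le ?_ ?_ (by norm_num)).trans (add_le_add ?_ ?_)
  · exact ((Complex.measurable_ofReal.comp (hc'.sub hc)).mul hm1).aestronglyMeasurable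
  · exact ((Complex.measurable_ofReal.comp hc').mul (hm2.sub hm1)).aestronglyMeasurable
  · refine (eLpNorm_le_mul_eLpNorm_of_ae_le_mul (c := (haar : Measure G).real (symmDiff B' B))
      (g := rootFun m K) (Eventually.of_forall fun x => ?_) 2).trans ?_
    · rw [norm_mul, Complex.norm_real, Real.norm_eq_abs]
      gcongr
      exact abs_countFun_sub_le hBm hBm' hB hB' hC x
    · rw [ofReal_measureReal (measure_symmDiff_ne_top hB' hB)]
  · refine (eLpNorm_le_mul_eLpNorm_of_ae_le_mul (c := (haar : Measure G).real B')
      (g := fun x => rootFun m K' x - rootFun m K x) (Eventually.of_forall fun x => ?_) 2).trans ?_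
    · rw [norm_mul, Complex.norm_real, Real.norm_of_nonneg (countFun_nonneg _ _ _)]
      gcongr
      exact countFun_le hB' C x
    · rw [ofReal_measureReal hB']
      gcongr
      exact eLpNorm_rootFun_sub m hK hK'

/-- The vectors with continuous orbit at the identity. -/
noncomputable def continuousVectors : Submodule ℂ (Lp ℂ 2 m) where
  carrier := {ξ | Tendsto (fun g : G => koopmanIsometry m g ξ) (𝓝 1) (𝓝 ξ)}
  add_mem' {a b} ha hb := by
    simp only [Set.mem_ofPred_eq, map_add] at *
    exact ha.add hb
  zero_mem' := by simp
  smul_mem' c a ha := by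
    simp only [Set.mem_ofPred_eq, map_smul] at *
    exact ha.const_smul c

theorem isClosed_continuousVectors :
    IsClosed (continuousVectors (G := G) m : Set (Lp ℂ 2 m)) := by
  refine isClosed_of_closure_subset fun ξ hξ => ?_
  change Tendsto (fun g : G => koopmanIsometry m g ξ) (𝓝 1) (𝓝 ξ)
  rw [Metric.tendsto_nhds]
  intro ε hε
  obtain ⟨η, hη, hd⟩ := Metric.mem_closure_iff.1 hξ (ε / 3) (by positivity)
  have hη' : Tendsto (fun g : G => koopmanIsometry m g η) (𝓝 1) (𝓝 η) := hη
  filter_upwards [Metric.tendsto_nhds.1 hη' (ε / 3) (by positivity)] with g hg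
  have h1 : dist (koopmanIsometry m g ξ) (koopmanIsometry m g η) = dist ξ η :=
    (koopmanIsometry m g).dist_map ξ η
  have h2 := dist_triangle4 (koopmanIsometry m g ξ) (koopmanIsometry m g η) η ξ
  rw [dist_comm η ξ] at h2
  linarith

theorem testFun_mem {B : Set G} (hBm : MeasurableSet B) (hB : haar B ≠ ∞) {C : Set X}
    (hC : MeasurableSet C) {K : Set G} (hKm : MeasurableSet K) (hK : haar K ≠ ∞) :
    (memLp_testFun m hBm hB hC hK).toLp ∈ continuousVectors (G := G) m := by
  change Tendsto (fun g : G => koopmanIsometry m g _) (𝓝 1) (𝓝 _)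
  rw [tendsto_iff_edist_tendsto_0]
  have hlim : Tendsto (fun g : G => haar (symmDiff (shift g B) B) * eLpNorm (rootFun m K) 2 m
        + haar B * (m.toFinite Set.univ * haar (symmDiff (shift g K) K)) ^ (1 / 2 : ℝ))
      (𝓝 1) (𝓝 0) := by
    have t1 := ENNReal.Tendsto.mul_const (b := eLpNorm (rootFun m K) 2 m)
      (tendsto_haar_shift hBm hB) (Or.inr (memLp_rootFun m hK).2.ne)
    have t2 := ENNReal.Tendsto.const_mul (a := m.toFinite Set.univ)
      (tendsto_haar_shift hKm hK) (Or.inr (measure_ne_top _ _))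
    have t3 := ENNReal.Tendsto.const_mul (a := haar B)
      (t2.ennrpow_const (1 / 2 : ℝ)) (Or.inr hB)
    simpa using t1.add t3
  refine tendsto_of_tendsto_of_tendsto_of_le_of_le tendsto_const_nhds hlim
    (fun _ => zero_le) fun g => ?_
  have hsB : haar (shift g B) ≠ ∞ := by rwa [haar_shift]
  have hsK : haar (shift g K) ≠ ∞ := by rwa [haar_shift]
  have h := eLpNorm_testFun_sub m hBm (measurableSet_shift g hBm) hB hsB hC hK hsK
  rw [haar_shift g B] at h
  refine le_trans (le_of_eq ?_) h
  dsimp only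
  rw [Lp.edist_def]
  refine eLpNorm_congr_ae ?_
  filter_upwards [koopmanIsometry_ae m g (memLp_testFun m hBm hB hC hK).toLp,
    (memLp_testFun m hBm hB hC hK).coeFn_toLp,
    ae_smul m g⁻¹ (memLp_testFun m hBm hB hC hK).coeFn_toLp,
    koopmanFun_rootFun m g hKm hK] with x h1 h2 h3 h4
  simp only [Pi.sub_apply, h1, h2]
  congr 1
  rw [koopmanFun, h3, testFun, testFun, ← h4, koopmanFun, countFun_smul]
  ring

theorem integral_eq_zero_of_orthogonal {K : Set G} (hKm : MeasurableSet K) (hK : haar K ≠ ∞)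
    {η : Lp ℂ 2 m} (hη : ∀ ξ ∈ continuousVectors (G := G) m, inner ℂ ξ η = 0)
    {S : Set (G × X)} (hS : MeasurableSet S) :
    ∫ p in {p : G × X | (p.1, p.1⁻¹ • p.2) ∈ S}, rootFun m K p.2 * η p.2
      ∂((haar.restrict K).prod m) = 0 := by
  have hmap : Measurable fun p : G × X => (p.1, p.1⁻¹ • p.2) :=
    measurable_fst.prodMk (measurable_fst.inv.smul measurable_snd)
  have hfin : IsFiniteMeasure ((haar : Measure G).restrict K) :=
    ⟨by rw [restrict_apply_univ]; exact hK.lt_top⟩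
  have hint0 : Integrable (fun x => rootFun m K x * η x) m :=
    (memLp_rootFun m hK).integrable_mul (Lp.memLp η)
  have hint : Integrable (fun p : G × X => rootFun m K p.2 * η p.2)
      ((haar.restrict K).prod m) := hint0.comp_snd _
  have hrect : ∀ (B : Set G) (C : Set X), MeasurableSet B → MeasurableSet C →
      ∫ p in {p : G × X | (p.1, p.1⁻¹ • p.2) ∈ B ×ˢ C}, rootFun m K p.2 * η p.2
        ∂((haar.restrict K).prod m) = 0 := by
    intro B C hB hC
    have hT : MeasurableSet {p : G × X | (p.1, p.1⁻¹ • p.2) ∈ B ×ˢ C} := hmap (hB.prod hC)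
    have hBK : haar (B ∩ K) ≠ ∞ := ne_top_of_le_ne_top hK (measure_mono Set.inter_subset_right)
    have h0 := hη _ (testFun_mem m (hB.inter hKm) hBK hC hKm hK)
    rw [← integral_indicator hT, integral_prod_symm _ (hint.indicator hT)]
    rw [L2.inner_def] at h0
    rw [← h0]
    refine integral_congr_ae ?_
    filter_upwards [(memLp_testFun m (hB.inter hKm) hBK hC hK).coeFn_toLp] with x hx
    rw [hx]
    have hs : MeasurableSet {h : G | h ∈ B ∧ h⁻¹ • x ∈ C} := measurableSet_countFun hB hC x
    have e1 : (fun h : G => ({p : G × X | (p.1, p.1⁻¹ • p.2) ∈ B ×ˢ C}).indicator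
        (fun p => rootFun m K p.2 * η p.2) (h, x))
        = ({h : G | h ∈ B ∧ h⁻¹ • x ∈ C}).indicator (fun _ => rootFun m K x * η x) := by
      ext h
      by_cases hh : h ∈ B ∧ h⁻¹ • x ∈ C
      · have h1 : (h, x) ∈ {p : G × X | (p.1, p.1⁻¹ • p.2) ∈ B ×ˢ C} := hh
        have h2 : h ∈ {h : G | h ∈ B ∧ h⁻¹ • x ∈ C} := hh
        rw [Set.indicator_of_mem h1, Set.indicator_of_mem h2]
      · have h1 : (h, x) ∉ {p : G × X | (p.1, p.1⁻¹ • p.2) ∈ B ×ˢ C} := hh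
        have h2 : h ∉ {h : G | h ∈ B ∧ h⁻¹ • x ∈ C} := hh
        rw [Set.indicator_of_notMem h1, Set.indicator_of_notMem h2]
    have e2 : ((haar : Measure G).restrict K).real {h : G | h ∈ B ∧ h⁻¹ • x ∈ C}
        = countFun (B ∩ K) C x := by
      rw [measureReal_restrict_apply hs, countFun]
      congr 1
      ext h
      simp only [Set.mem_inter_iff, Set.mem_ofPred_eq]
      tauto
    rw [e1, integral_indicator_const _ hs, e2]
    simp only [RCLike.inner_apply, testFun, rootFun, map_mul, Complex.conj_ofReal,
      Complex.real_smul]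
    ring
  have hpi := generateFrom_prod (α := G) (β := X)
  induction S, hS using MeasurableSpace.induction_on_inter hpi.symm isPiSystem_prod with
  | empty => simp
  | basic t ht =>
    obtain ⟨B, hB, C, hC, rfl⟩ := ht
    exact hrect B C hB hC
  | compl t ht ih =>
    have huniv := hrect Set.univ Set.univ MeasurableSet.univ MeasurableSet.univ
    simp only [Set.univ_prod_univ, Set.mem_univ, Set.ofPred_true, setIntegral_univ] at huniv
    have e : {p : G × X | (p.1, p.1⁻¹ • p.2) ∈ tᶜ} = {p : G × X | (p.1, p.1⁻¹ • p.2) ∈ t}ᶜ := rfl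
    have ht' : MeasurableSet {p : G × X | (p.1, p.1⁻¹ • p.2) ∈ t} := hmap ht
    rw [e, setIntegral_compl ht' hint, huniv, ih, sub_zero]
  | iUnion f hd hf ih =>
    have e : {p : G × X | (p.1, p.1⁻¹ • p.2) ∈ ⋃ i, f i}
        = ⋃ i, {p : G × X | (p.1, p.1⁻¹ • p.2) ∈ f i} := by
      ext; simp
    have hf' : ∀ i, MeasurableSet {p : G × X | (p.1, p.1⁻¹ • p.2) ∈ f i} := fun i => hmap (hf i)
    rw [e, integral_iUnion hf'
      (fun i j hij => (hd hij).preimage fun p : G × X => (p.1, p.1⁻¹ • p.2)) hint.integrableOn]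
    simp [ih]

theorem continuousVectors_eq_top : continuousVectors (G := G) m = ⊤ := by
  rw [← (isClosed_continuousVectors (G := G) m).submodule_topologicalClosure_eq,
    Submodule.topologicalClosure_eq_top_iff, Submodule.eq_bot_iff]
  intro η hη
  have hη' : ∀ ξ ∈ continuousVectors (G := G) m, inner ℂ ξ η = 0 := hη
  obtain ⟨K⟩ : Nonempty (TopologicalSpace.PositiveCompacts G) := inferInstance
  have hKm : MeasurableSet (K : Set G) := K.isCompact.measurableSet
  have hK : haar (K : Set G) ≠ ∞ := K.isCompact.measure_ne_top
  have hK0 : haar (K : Set G) ≠ 0 := (measure_pos_of_nonempty_interior _ K.interior_nonempty).ne'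
  have hint0 : Integrable (fun x => rootFun m (K : Set G) x * η x) m :=
    (memLp_rootFun m hK).integrable_mul (Lp.memLp η)
  have hz := hint0.ae_eq_zero_of_forall_setIntegral_eq_zero fun A hA _ => by
    have hS : MeasurableSet {p : G × X | p.1 • p.2 ∈ A} :=
      (measurable_fst.smul measurable_snd) hA
    have h := integral_eq_zero_of_orthogonal m hKm hK hη' hS
    have e : {p : G × X | (p.1, p.1⁻¹ • p.2) ∈ {p : G × X | p.1 • p.2 ∈ A}}
        = Set.univ ×ˢ A := by
      ext; simp
    rw [e, ← prod_restrict, integral_fun_snd (fun x => rootFun m (K : Set G) x * η x)] at h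
    simpa [measureReal_def, ENNReal.toReal_eq_zero_iff, hK0, hK] using h
  ext1
  have := isFiniteMeasure_smear m hK
  filter_upwards [hz, rnDeriv_pos' (ac_smear m hK0), rnDeriv_lt_top (smear m (K : Set G)) m,
    Lp.coeFn_zero ℂ 2 m] with x h1 h2 h3 h4
  rw [h4]
  have h5 : rootFun m (K : Set G) x ≠ 0 := by
    simp only [rootFun, ne_eq, Complex.ofReal_eq_zero]
    exact (Real.sqrt_pos.2 (ENNReal.toReal_pos h2.ne' h3.ne)).ne'
  simpa [h5] using h1

theorem continuous_koopmanHom (ξ : Lp ℂ 2 m) : Continuous fun g : G => koopmanHom m g ξ := by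
  have h1 : ξ ∈ continuousVectors (G := G) m := by
    rw [continuousVectors_eq_top]
    trivial
  have h2 : Tendsto (fun g : G => koopmanHom m g ξ) (𝓝 1) (𝓝 ξ) := h1
  rw [continuous_iff_continuousAt]
  intro g₀
  have h3 : Tendsto (fun g : G => g₀⁻¹ * g) (𝓝 g₀) (𝓝 1) := by
    have : Continuous fun g : G => g₀⁻¹ * g := by fun_prop
    simpa using this.tendsto g₀
  have h4 := ((koopmanHom m g₀).continuous.tendsto ξ).comp (h2.comp h3)
  refine h4.congr fun g => ?_
  change koopmanHom m g₀ (koopmanHom m (g₀⁻¹ * g) ξ) = _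
  have e := map_mul (koopmanHom (G := G) m) g₀ (g₀⁻¹ * g)
  rw [mul_inv_cancel_left] at e
  rw [e]
  rfl

end Continuity

section UnitaryRep

/-- A (strongly continuous) unitary representation of `G` on a complex inner product space. -/
structure UnitaryRep (G H : Type*) [Group G] [TopologicalSpace G] [NormedAddCommGroup H]
    [InnerProductSpace ℂ H] where
  /-- the unitary operators -/
  toHom : G →* (H ≃ₗᵢ[ℂ] H)
  continuous_orbit : ∀ ξ : H, Continuous fun g => toHom g ξ

/-- There are a compact set `Q` and `ε > 0` with `sup_{s ∈ Q} ‖π(s)ξ - ξ‖ ≥ ε ‖ξ‖` for all `ξ`.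
The supremum is over a set bounded by `2 ‖ξ‖`. -/
def UnitaryRep.HasSpectralGapProperty {G H : Type*} [Group G] [TopologicalSpace G]
    [NormedAddCommGroup H] [InnerProductSpace ℂ H] (π : UnitaryRep G H) : Prop :=
  ∃ Q : Set G, IsCompact Q ∧ ∃ ε : ℝ, 0 < ε ∧
    ∀ ξ : H, ε * ‖ξ‖ ≤ ⨆ s : Q, ‖π.toHom s ξ - ξ‖

variable {G H : Type*} [Group G] [TopologicalSpace G] [SecondCountableTopology G]
  [MeasurableSpace G] [BorelSpace G] [NormedAddCommGroup H] [InnerProductSpace ℂ H]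

theorem UnitaryRep.integrable_orbit (π : UnitaryRep G H) (μ : Measure G) [IsProbabilityMeasure μ]
    (ξ : H) : Integrable (fun g => π.toHom g ξ) μ := by
  refine Integrable.of_bound (C := ‖ξ‖) (π.continuous_orbit ξ).aestronglyMeasurable ?_
  exact Eventually.of_forall fun g => ((π.toHom g).norm_map ξ).le

/-- The averaging operator `π(μ) ξ = ∫ π(g) ξ dμ(g)`. -/
noncomputable def UnitaryRep.average (π : UnitaryRep G H) (μ : Measure G)
    [IsProbabilityMeasure μ] : H →L[ℂ] H :=
  LinearMap.mkContinuous
    { toFun := fun ξ => ∫ g, π.toHom g ξ ∂μ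
      map_add' := fun ξ η => by
        simp only [map_add]
        exact integral_add (π.integrable_orbit μ ξ) (π.integrable_orbit μ η)
      map_smul' := fun c ξ => by
        simp only [map_smul, RingHom.id_apply]
        exact integral_smul c _ }
    1 fun ξ => by
      rw [one_mul]
      have h := norm_integral_le_of_norm_le_const (μ := μ) (f := fun g => π.toHom g ξ) (C := ‖ξ‖)
        (Eventually.of_forall fun g => ((π.toHom g).norm_map ξ).le)
      simpa using h

end UnitaryRep

/-- The Koopman representation of `G` on `L²(X, m)`:
`(π_X(g) f)(x) = (dm(g⁻¹ x)/dm(x))^(1/2) f(g⁻¹ x)`. -/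
noncomputable def koopmanRep (G : Type*) {X : Type*} [Group G] [TopologicalSpace G]
    [IsTopologicalGroup G] [LocallyCompactSpace G] [SecondCountableTopology G] [T2Space G]
    [MeasurableSpace G] [BorelSpace G] [MulAction G X] [MeasurableSpace X]
    [MeasurableSMul₂ G X] (m : Measure X) [SigmaFinite m] [QuasiInvariant G m] :
    UnitaryRep G (Lp ℂ 2 m) where
  toHom := koopmanHom m
  continuous_orbit := continuous_koopmanHom m

section Adapted

variable {G : Type*} [Group G] [TopologicalSpace G] [MeasurableSpace G]

/-- The support of `μ` generates a dense subgroup. -/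
def IsAdapted (μ : Measure G) : Prop :=
  Dense (Subgroup.closure μ.support : Set G)

/-- The support of `μ` is not contained in a coset of a proper closed subgroup.
(As `L g = g (g⁻¹ L g)`, left cosets and right cosets give the same condition.) -/
def IsStronglyAdapted (μ : Measure G) : Prop :=
  ∀ L : Subgroup G, IsClosed (L : Set G) → L ≠ ⊤ →
    ∀ g : G, ¬ μ.support ⊆ (fun h => g * h) '' (L : Set G)

end Adapted

section Coamenable

variable {G X : Type*} [Group G] [MeasurableSpace G] [MulAction G X] [MeasurableSpace X]
  [MeasurableSMul₂ G X] (m : Measure X) [QuasiInvariant G m]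

theorem memLp_top_smul (g : G) (φ : Lp ℂ ∞ m) : MemLp (fun x => φ (g⁻¹ • x)) ∞ m := by
  have hq : Measure.QuasiMeasurePreserving (fun x : X => g⁻¹ • x) m m :=
    ⟨measurable_const_smul g⁻¹, QuasiInvariant.map_ac g⁻¹⟩
  obtain ⟨C, hC⟩ := eLpNormEssSup_lt_top_iff_isBoundedUnder.1
    (by simpa using Lp.eLpNorm_lt_top φ)
  refine memLp_top_of_bound ((Lp.aestronglyMeasurable φ).comp_quasiMeasurePreserving hq) C ?_
  exact hq.ae (by simpa using hC)

/-- The translate `x ↦ φ(g⁻¹ x)` of `φ ∈ L^∞(X, m)`. -/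
noncomputable def translate (g : G) (φ : Lp ℂ ∞ m) : Lp ℂ ∞ m := (memLp_top_smul m g φ).toLp

open scoped ComplexOrder in
/-- There is a `G`-invariant mean on `L^∞(X, m)`: a positive linear functional `M` with
`M(1) = 1` that is invariant under all translations by elements of `G`. -/
def IsCoamenable (G : Type*) {X : Type*} [Group G] [MeasurableSpace G] [MulAction G X]
    [MeasurableSpace X] [MeasurableSMul₂ G X] (m : Measure X) [QuasiInvariant G m] : Prop :=
  ∃ M : Lp ℂ ∞ m →ₗ[ℂ] ℂ,
    (∀ φ : Lp ℂ ∞ m, (∀ᵐ x ∂m, 0 ≤ φ x) → 0 ≤ M φ) ∧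
    M (memLp_top_const (1 : ℂ)).toLp = 1 ∧
    ∀ (g : G) (φ : Lp ℂ ∞ m), M (translate m g φ) = M φ

end Coamenable

end CoamenableAction

/-! All five conditions reduce to the existence of almost invariant unit vectors in L²(X, m), which
is the negation of the Spectral Gap Property.

From vectors to means. For a unit vector ξ, the formula φ ↦ ∫ φ |ξ|² dm is a mean, and the Koopman
weight is chosen so that π(g)ξ induces the translated mean. A limit along an ultrafilter of the
means of unit vectors η_n is invariant under every g with ‖π(g)η_n - η_n‖ → 0
(`hasInvariantMean_of_seq`).

From means to vectors. The mean N may be invariant only under a dense set H of translations, and it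
need be neither countably additive nor continuous under translation. The remedy is to smooth over G:
for bounded φ, the map k ↦ N(∫ k(g) φ(g⁻¹x) dg) is a continuous functional on L¹(G), hence given by
a bounded function on G, and invariance under H forces this function to be constant
(`ae_eq_const_of_setIntegral_shift`). So N does not distinguish averages of φ against absolutely
continuous measures on G of equal mass (`IsMean.exists_average_eq`). A Hahn–Banach separation turns
this into probability measures τ ≪ m for which ν ∗ τ is almost invariant under finitely many
translations. With ν the restriction of Haar measure to a compact set, continuity of translation
extends this to compact sets, and square roots of densities carry it to L²
(`IsMean.exists_almost_invariant_vector`).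

Averaging operators. Almost invariant vectors make 1 a spectral value of every π(μ). Conversely, let
‖π(μ)ξ_n‖ → 1, or π(μ)ξ_n - zξ_n → 0 with |z| = 1. The identity
`UnitaryRep.integral_norm_orbit_sub_sq` then shows that, along a subsequence and for μ-almost every
g, π(g)ξ_n approaches a vector independent of g. Comparing two such g (first case), or passing to
moduli to remove z (second case), gives unit vectors asymptotically fixed by a subgroup, which
adaptedness makes dense. This subgroup need not be closed, which is why means invariant under a mere
dense set must be handled. -/

namespace CoamenableAction

set_option linter.unusedSectionVars false

/-! ### Duality between L¹ and L^∞ for σ-finite measures -/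

section Duality

variable {α : Type*} [MeasurableSpace α]

/-- Continuous functionals on `L¹` of a finite measure are given by bounded functions. -/
theorem exists_bounded_density_of_isFiniteMeasure (μ : Measure α) [IsFiniteMeasure μ]
    (Λ : Lp ℝ 1 μ →L[ℝ] ℝ) :
    ∃ ψ : α → ℝ, Measurable ψ ∧ (∀ x, |ψ x| ≤ ‖Λ‖) ∧ ∀ k : Lp ℝ 1 μ, Λ k = ∫ x, k x * ψ x ∂μ := by
  have one2 : MemLp (fun _ : α => (1 : ℝ)) 2 μ := memLp_const 1
  -- Over a finite measure L² embeds in L¹, here as Hölder multiplication by the constant 1. Pulled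
  -- back along `J`, the functional has a Riesz vector `ζ` in L².
  let J : Lp ℝ 2 μ →L[ℝ] Lp ℝ 1 μ :=
    (ContinuousLinearMap.mul ℝ ℝ).holderL μ 2 2 1 one2.toLp
  have hJ : ∀ f : Lp ℝ 2 μ, J f =ᵐ[μ] f := by
    intro f
    filter_upwards [(ContinuousLinearMap.mul ℝ ℝ).coeFn_holder (r := 1) one2.toLp f,
      one2.coeFn_toLp] with x h1 h2
    refine h1.trans ?_
    rw [ContinuousLinearMap.mul_apply', h2, one_mul]
  let ζ : Lp ℝ 2 μ := (InnerProductSpace.toDual ℝ (Lp ℝ 2 μ)).symm (Λ.comp J)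
  have hζ : ∀ f : Lp ℝ 2 μ, Λ (J f) = ∫ x, f x * ζ x ∂μ := by
    intro f
    have h : inner ℝ ζ f = (Λ.comp J) f := InnerProductSpace.toDual_symm_apply
    rw [L2.inner_def] at h
    simpa using h.symm
  have hζi : Integrable ζ μ := (Lp.memLp ζ).integrable (by norm_num)
  -- The indicator of `s` has L¹-norm μ(s), so the mean of `ζ` over any non-null set is at most ‖Λ‖
  -- in absolute value; this bounds `ζ` almost everywhere.
  have hind : ∀ s : Set α, MeasurableSet s →
      |∫ x in s, ζ x ∂μ| ≤ ‖Λ‖ * μ.real s := by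
    intro s hs
    have h := hζ (indicatorConstLp 2 hs (measure_ne_top μ s) 1)
    have e1 : ∫ x, indicatorConstLp 2 hs (measure_ne_top μ s) (1 : ℝ) x * ζ x ∂μ
        = ∫ x in s, ζ x ∂μ := by
      rw [← integral_indicator hs]
      refine integral_congr_ae ?_
      filter_upwards [indicatorConstLp_coeFn (p := 2) (hs := hs) (hμs := measure_ne_top μ s)
        (c := (1 : ℝ))] with x hx
      rw [hx]
      by_cases hxs : x ∈ s <;> simp [hxs]
    rw [← e1, ← h, ← Real.norm_eq_abs]
    refine (Λ.le_opNorm _).trans (mul_le_mul_of_nonneg_left ?_ (norm_nonneg _))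
    have e2 : J (indicatorConstLp 2 hs (measure_ne_top μ s) (1 : ℝ))
        = indicatorConstLp 1 hs (measure_ne_top μ s) (1 : ℝ) := by
      ext1
      exact (hJ _).trans (indicatorConstLp_coeFn.trans indicatorConstLp_coeFn.symm)
    rw [e2, norm_indicatorConstLp one_ne_zero ENNReal.one_ne_top]
    simp
  have hup : ∀ᵐ x ∂μ, ζ x ≤ ‖Λ‖ := by
    refine ae_le_of_forall_setIntegral_le hζi (integrable_const _) fun s hs _ => ?_
    refine (le_abs_self _).trans ((hind s hs).trans (le_of_eq ?_))
    simp [mul_comm]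
  have hlow : ∀ᵐ x ∂μ, -‖Λ‖ ≤ ζ x := by
    refine ae_le_of_forall_setIntegral_le (integrable_const _) hζi fun s hs _ => ?_
    refine le_trans (le_of_eq ?_) (neg_le_of_abs_le (hind s hs))
    simp [mul_comm]
  have hζm : Measurable ζ := (Lp.stronglyMeasurable ζ).measurable
  -- Truncation at ±‖Λ‖ changes `ζ` on a null set only and makes the bound hold at every point.
  refine ⟨fun x => max (-‖Λ‖) (min ‖Λ‖ (ζ x)), by fun_prop, fun x => ?_, ?_⟩
  · rw [abs_le]
    exact ⟨le_max_left _ _, max_le (by linarith [norm_nonneg Λ]) (min_le_left _ _)⟩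
  set ψ : α → ℝ := fun x => max (-‖Λ‖) (min ‖Λ‖ (ζ x)) with hψ
  have hψζ : ψ =ᵐ[μ] ζ := by
    filter_upwards [hup, hlow] with x h1 h2
    simp [hψ, h1, h2]
  have hψm : Measurable ψ := by fun_prop
  have hψb : ∀ x, ‖ψ x‖ ≤ ‖Λ‖ := fun x => by
    rw [Real.norm_eq_abs, abs_le]
    exact ⟨le_max_left _ _, max_le (by linarith [norm_nonneg Λ]) (min_le_left _ _)⟩
  have hint : ∀ k : Lp ℝ 1 μ, Integrable (fun x => k x * ψ x) μ := fun k =>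
    (L1.integrable_coeFn k).mul_bdd hψm.aestronglyMeasurable (Eventually.of_forall hψb)
  -- Once integration against `ψ` is a continuous functional on L¹, its equality with `Λ` need only
  -- be checked on indicators.
  let Ψ : Lp ℝ 1 μ →L[ℝ] ℝ := LinearMap.mkContinuous
    { toFun := fun k => ∫ x, k x * ψ x ∂μ
      map_add' := fun k l => by
        rw [← integral_add (hint k) (hint l)]
        refine integral_congr_ae ?_
        filter_upwards [Lp.coeFn_add k l] with x hx
        rw [hx, Pi.add_apply, add_mul]
      map_smul' := fun c k => by
        rw [RingHom.id_apply, smul_eq_mul, ← integral_const_mul]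
        refine integral_congr_ae ?_
        filter_upwards [Lp.coeFn_smul c k] with x hx
        rw [hx, Pi.smul_apply, smul_eq_mul, mul_assoc] } ‖Λ‖ fun k => by
      have h1 : ‖∫ x, k x * ψ x ∂μ‖ ≤ ∫ x, ‖Λ‖ * ‖k x‖ ∂μ := by
        refine norm_integral_le_of_norm_le ((L1.integrable_coeFn k).norm.const_mul _)
          (Eventually.of_forall fun x => ?_)
        rw [norm_mul, mul_comm]
        gcongr
        exact hψb x
      rw [integral_const_mul] at h1
      rwa [L1.norm_eq_integral_norm]
  have hΨ : ∀ k : Lp ℝ 1 μ, Ψ k = ∫ x, k x * ψ x ∂μ := fun k => rfl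
  suffices h : Λ = Ψ by intro k; rw [← hΨ, h]
  ext k
  refine Lp.induction ENNReal.one_ne_top (motive := fun k => Λ k = Ψ k) ?_ ?_ ?_ k
  · intro c s hs hμs
    change Λ (indicatorConstLp 1 hs hμs.ne c) = Ψ (indicatorConstLp 1 hs hμs.ne c)
    have h := hζ (indicatorConstLp 2 hs hμs.ne c)
    have e2 : J (indicatorConstLp 2 hs hμs.ne c) = indicatorConstLp 1 hs hμs.ne c := by
      ext1
      exact (hJ _).trans (indicatorConstLp_coeFn.trans indicatorConstLp_coeFn.symm)
    rw [← e2, h, hΨ]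
    refine integral_congr_ae ?_
    filter_upwards [hJ (indicatorConstLp 2 hs hμs.ne c), hψζ] with x h1 h2
    rw [h1, h2]
  · intro f g hf hg _ h1 h2
    rw [map_add, map_add, h1, h2]
  · exact isClosed_eq Λ.continuous Ψ.continuous

/-- Continuous functionals on `L¹` of a σ-finite measure are given by bounded functions. -/
theorem exists_bounded_density (μ : Measure α) [SigmaFinite μ] (Λ : Lp ℝ 1 μ →L[ℝ] ℝ) :
    ∃ ψ : α → ℝ, Measurable ψ ∧ (∃ C, ∀ x, |ψ x| ≤ C) ∧
      ∀ k : Lp ℝ 1 μ, Λ k = ∫ x, k x * ψ x ∂μ := by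
  -- Reduction to a finite measure: multiplication by a positive integrable weight `w` embeds L¹(wμ)
  -- isometrically in L¹(μ), and k is the image of k/w.
  obtain ⟨w, hw0, hw, hwi⟩ := exists_pos_lintegral_lt_of_sigmaFinite μ one_ne_zero
  have hfin : IsFiniteMeasure (μ.withDensity fun x => (w x : ℝ≥0∞)) :=
    isFiniteMeasure_withDensity (hwi.trans ENNReal.one_lt_top).ne
  let I := withDensitySMulLI (E := ℝ) μ hw
  obtain ⟨ψ, hψ, hb, h⟩ := exists_bounded_density_of_isFiniteMeasure _
    (Λ.comp I.toContinuousLinearMap)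
  refine ⟨ψ, hψ, ⟨_, hb⟩, fun k => ?_⟩
  have hki : Integrable (fun x => (w x : ℝ)⁻¹ * k x) (μ.withDensity fun x => (w x : ℝ≥0∞)) := by
    rw [integrable_withDensity_iff_integrable_smul hw]
    refine (L1.integrable_coeFn k).congr (Eventually.of_forall fun x => ?_)
    simp only [NNReal.smul_def, smul_eq_mul]
    rw [mul_inv_cancel_left₀]
    exact_mod_cast (hw0 x).ne'
  have hae := ((withDensity_absolutelyContinuous' (μ := μ)
    hw.coe_nnreal_ennreal.aemeasurable (Eventually.of_forall fun x => by
      simpa using (hw0 x).ne')).ae_le hki.coeFn_toL1)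
  have e : I hki.toL1 = k := by
    ext1
    refine (memL1_smul_of_L1_withDensity hw hki.toL1).coeFn_toLp.trans ?_
    filter_upwards [hae] with x hx
    rw [hx]
    simp only [NNReal.smul_def, smul_eq_mul]
    rw [mul_inv_cancel_left₀]
    exact_mod_cast (hw0 x).ne'
  have h1 := h hki.toL1
  simp only [ContinuousLinearMap.comp_apply] at h1
  have h2 : Λ (I hki.toL1) = Λ k := by rw [e]
  rw [← h2]
  refine h1.trans ?_
  rw [integral_withDensity_eq_integral_smul hw]
  refine integral_congr_ae ?_
  filter_upwards [hae] with x hx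
  rw [hx]
  simp only [NNReal.smul_def, smul_eq_mul]
  rw [mul_assoc, mul_inv_cancel_left₀]
  exact_mod_cast (hw0 x).ne'

end Duality

/-! ### Finitely additive means on bounded measurable functions -/

section Mean

variable {X : Type*} [MeasurableSpace X]

/-- Bounded measurable real functions. -/
def BddMeasurable (φ : X → ℝ) : Prop := Measurable φ ∧ ∃ C, ∀ x, |φ x| ≤ C

theorem BddMeasurable.add {φ ψ : X → ℝ} (hφ : BddMeasurable φ) (hψ : BddMeasurable ψ) :
    BddMeasurable fun x => φ x + ψ x := by
  obtain ⟨hφ, C, hC⟩ := hφ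
  obtain ⟨hψ, D, hD⟩ := hψ
  exact ⟨hφ.add hψ, C + D, fun x => (abs_add_le _ _).trans (add_le_add (hC x) (hD x))⟩

theorem BddMeasurable.const_mul {φ : X → ℝ} (hφ : BddMeasurable φ) (c : ℝ) :
    BddMeasurable fun x => c * φ x := by
  obtain ⟨hφ, C, hC⟩ := hφ
  exact ⟨hφ.const_mul c, |c| * C, fun x => by rw [abs_mul]; gcongr; exact hC x⟩

theorem bddMeasurable_const (c : ℝ) : BddMeasurable fun _ : X => c :=
  ⟨measurable_const, |c|, fun _ => le_rfl⟩

theorem BddMeasurable.sub {φ ψ : X → ℝ} (hφ : BddMeasurable φ) (hψ : BddMeasurable ψ) :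
    BddMeasurable fun x => φ x - ψ x := by
  have h := hφ.add (hψ.const_mul (-1))
  simpa [sub_eq_add_neg] using h

theorem BddMeasurable.finsetSum {ι : Type*} (s : Finset ι) {φ : ι → X → ℝ}
    (hφ : ∀ i, BddMeasurable (φ i)) : BddMeasurable fun x => ∑ i ∈ s, φ i x := by
  classical
  induction s using Finset.induction_on with
  | empty => simpa using bddMeasurable_const (X := X) 0
  | insert a s ha ih => simpa [Finset.sum_insert ha] using (hφ a).add ih

theorem BddMeasurable.integrable {φ : X → ℝ} (hφ : BddMeasurable φ) (μ : Measure X)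
    [IsFiniteMeasure μ] : Integrable φ μ := by
  obtain ⟨hφ, C, hC⟩ := hφ
  exact Integrable.of_bound hφ.aestronglyMeasurable C (Eventually.of_forall hC)

/-- A mean on the bounded measurable real functions, compatible with equality `m`-a.e. -/
structure IsMean (m : Measure X) (N : (X → ℝ) → ℝ) : Prop where
  add : ∀ {φ ψ : X → ℝ}, BddMeasurable φ → BddMeasurable ψ → N (fun x => φ x + ψ x) = N φ + N ψ
  const_mul : ∀ (c : ℝ) {φ : X → ℝ}, BddMeasurable φ → N (fun x => c * φ x) = c * N φ
  mono : ∀ {φ ψ : X → ℝ}, BddMeasurable φ → BddMeasurable ψ → φ ≤ᵐ[m] ψ → N φ ≤ N ψ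
  one : N (fun _ => 1) = 1

namespace IsMean

variable {m : Measure X} {N : (X → ℝ) → ℝ}

theorem const (hN : IsMean m N) (c : ℝ) : N (fun _ => c) = c := by
  have h := hN.const_mul c (bddMeasurable_const (X := X) 1)
  simpa [hN.one] using h

theorem sub (hN : IsMean m N) {φ ψ : X → ℝ} (hφ : BddMeasurable φ) (hψ : BddMeasurable ψ) :
    N (fun x => φ x - ψ x) = N φ - N ψ := by
  have h := hN.add hφ (hψ.const_mul (-1))
  rw [hN.const_mul _ hψ] at h
  simpa [sub_eq_add_neg] using h

theorem finsetSum (hN : IsMean m N) {ι : Type*} (s : Finset ι) {φ : ι → X → ℝ}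
    (hφ : ∀ i, BddMeasurable (φ i)) : N (fun x => ∑ i ∈ s, φ i x) = ∑ i ∈ s, N (φ i) := by
  classical
  induction s using Finset.induction_on with
  | empty => simpa using hN.const 0
  | insert a s ha ih =>
    simp only [Finset.sum_insert ha]
    rw [hN.add (hφ a) (BddMeasurable.finsetSum s hφ), ih]

theorem abs_apply_le (hN : IsMean m N) {φ : X → ℝ} (hφ : BddMeasurable φ) {C : ℝ}
    (hC : ∀ x, |φ x| ≤ C) : |N φ| ≤ C := by
  rw [abs_le]
  constructor
  · rw [← hN.const (-C)]
    exact hN.mono (bddMeasurable_const _) hφ (Eventually.of_forall fun x => neg_le_of_abs_le (hC x))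
  · rw [← hN.const C]
    exact hN.mono hφ (bddMeasurable_const _) (Eventually.of_forall fun x => le_of_abs_le (hC x))

end IsMean

end Mean

/-! ### Invariance under a dense set of translations, smoothed over the group -/

section Averaging

open Measure

variable {G X : Type*} [Group G] [TopologicalSpace G] [IsTopologicalGroup G]
  [LocallyCompactSpace G] [SecondCountableTopology G] [T2Space G]
  [MeasurableSpace G] [BorelSpace G] [MulAction G X] [MeasurableSpace X]
  [MeasurableSMul₂ G X]

/-- A function whose integrals over the left translates of sets agree along a dense set of
translations is constant almost everywhere. -/
theorem ae_eq_const_of_setIntegral_shift {H : Set G} (hH : Dense H) {ψ : G → ℝ}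
    (hψ : BddMeasurable ψ)
    (hinv : ∀ t ∈ H, ∀ B : Set G, MeasurableSet B → haar B ≠ ∞ →
      ∫ g in shift t B, ψ g ∂haar = ∫ g in B, ψ g ∂haar) :
    ∃ c, ∀ᵐ g ∂(haar : Measure G), ψ g = c := by
  obtain ⟨hψm, C, hC⟩ := hψ
  have hint : ∀ B : Set G, haar B ≠ ∞ → IntegrableOn ψ B haar := fun B hB =>
    have : IsFiniteMeasure ((haar : Measure G).restrict B) :=
      ⟨by rw [restrict_apply_univ]; exact hB.lt_top⟩
    Integrable.of_bound hψm.aestronglyMeasurable C (Eventually.of_forall hC)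
  have hall : ∀ (t : G) (B : Set G), MeasurableSet B → haar B ≠ ∞ →
      ∫ g in shift t B, ψ g ∂haar = ∫ g in B, ψ g ∂haar := by
    intro t B hBm hB
    have hsB : ∀ t : G, haar (shift t B) ≠ ∞ := fun t => by rwa [haar_shift]
    -- The integrals over tB and t₀B differ by at most C times the Haar measure of the symmetric
    -- difference, so they depend continuously on t; agreement on a dense set then gives agreement
    -- everywhere.
    have hcont : Continuous fun t : G => ∫ g in shift t B, ψ g ∂haar := by
      rw [continuous_iff_continuousAt]
      intro t₀
      have hlim : Tendsto (fun t : G => C * (haar : Measure G).real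
          (symmDiff (shift (t₀⁻¹ * t) B) B)) (𝓝 t₀) (𝓝 0) := by
        have h3 : Tendsto (fun g : G => t₀⁻¹ * g) (𝓝 t₀) (𝓝 1) := by
          have : Continuous fun g : G => t₀⁻¹ * g := by fun_prop
          simpa using this.tendsto t₀
        have h4 := (ENNReal.tendsto_toReal ENNReal.zero_ne_top).comp
          ((tendsto_haar_shift hBm hB).comp h3)
        simpa [Function.comp_def, measureReal_def] using h4.const_mul C
      rw [ContinuousAt, tendsto_iff_norm_sub_tendsto_zero]
      refine squeeze_zero (fun _ => norm_nonneg _) (fun t => ?_) hlim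
      have e : symmDiff (shift t B) (shift t₀ B) = shift t₀ (symmDiff (shift (t₀⁻¹ * t) B) B) := by
        ext h
        simp [shift, Set.mem_symmDiff, mul_assoc]
      have e' : (haar : Measure G).real (symmDiff (shift (t₀⁻¹ * t) B) B)
          = (haar : Measure G).real (symmDiff (shift t B) (shift t₀ B)) := by
        rw [e, measureReal_def, measureReal_def, haar_shift]
      rw [e', ← integral_indicator (measurableSet_shift t hBm),
        ← integral_indicator (measurableSet_shift t₀ hBm),
        ← integral_sub ((hint _ (hsB t)).integrable_indicator (measurableSet_shift t hBm))
          ((hint _ (hsB t₀)).integrable_indicator (measurableSet_shift t₀ hBm))]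
      have hmd : MeasurableSet (symmDiff (shift t B) (shift t₀ B)) :=
        (measurableSet_shift t hBm).symmDiff (measurableSet_shift t₀ hBm)
      have hfd := measure_symmDiff_ne_top (hsB t) (hsB t₀)
      have hb := norm_integral_le_of_norm_le (μ := (haar : Measure G))
        (f := fun a => (shift t B).indicator ψ a - (shift t₀ B).indicator ψ a)
        (g := (symmDiff (shift t B) (shift t₀ B)).indicator fun _ => C)
        ((integrable_indicator_iff hmd).2 (integrableOn_const hfd))
        (Eventually.of_forall fun g => ?_)
      · rw [integral_indicator_const _ hmd, smul_eq_mul, mul_comm] at hb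
        exact hb
      · have := hC g
        by_cases h1 : g ∈ shift t B <;> by_cases h2 : g ∈ shift t₀ B <;>
          simp [h1, h2, Set.mem_symmDiff, this]
    exact congrFun (Continuous.ext_on hH hcont continuous_const
      fun t ht => hinv t ht B hBm hB) t
  have hae : ∀ t : G, ∀ᵐ g ∂(haar : Measure G), ψ (t * g) = ψ g := by
    intro t
    refine ae_eq_of_forall_setIntegral_eq_of_sigmaFinite (f := fun g => ψ (t * g)) (g := ψ)
      (fun B _ hB => ?_) (fun B _ hB => hint B hB.ne) fun B hBm hB => ?_
    · have : IsFiniteMeasure ((haar : Measure G).restrict B) :=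
        ⟨by rw [restrict_apply_univ]; exact hB⟩
      exact Integrable.of_bound (hψm.comp (measurable_const_mul t)).aestronglyMeasurable C
        (Eventually.of_forall fun g => hC _)
    · rw [← hall t B hBm hB.ne, ← integral_indicator hBm,
        ← integral_indicator (measurableSet_shift t hBm),
        ← integral_mul_left_eq_self ((shift t B).indicator ψ) t]
      refine integral_congr_ae (Eventually.of_forall fun g => ?_)
      by_cases hg : g ∈ B
      · have : t * g ∈ shift t B := by simpa [shift] using hg
        simp [hg, this]
      · have : t * g ∉ shift t B := by simpa [shift] using hg
        simp [hg, this]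
  -- For each t, ψ(tg) = ψ(g) for almost every g. By Fubini some g₀ satisfies ψ(tg₀) = ψ(g₀) for
  -- almost every t. Right translation by g₀⁻¹ preserves Haar null sets, even when it does not
  -- preserve Haar measure.
  have hms : MeasurableSet {p : G × G | ψ (p.1 * p.2) = ψ p.2} :=
    measurableSet_eq_fun (hψm.comp measurable_mul) (hψm.comp measurable_snd)
  have hswap := (ae_ae_comm (μ := (haar : Measure G)) (ν := (haar : Measure G)) hms).1
    (Eventually.of_forall hae)
  obtain ⟨g₀, hg₀⟩ := hswap.exists
  refine ⟨ψ g₀, ?_⟩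
  have := (quasiMeasurePreserving_mul_right (haar : Measure G) g₀⁻¹).ae hg₀
  simpa using this

section Invariant

variable {m : Measure X} {N : (X → ℝ) → ℝ}

/-- `x ↦ ∫ k(g) φ(g⁻¹ x) dg`. -/
noncomputable def leftAverage (k : G → ℝ) (φ : X → ℝ) (x : X) : ℝ :=
  ∫ g, k g * φ (g⁻¹ • x) ∂haar

theorem integrable_leftAverage {k : G → ℝ} (hk : Integrable k haar) {φ : X → ℝ}
    (hφ : BddMeasurable φ) (x : X) :
    Integrable (fun g : G => k g * φ (g⁻¹ • x)) haar := by
  obtain ⟨hφ, C, hC⟩ := hφ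
  exact hk.mul_bdd (hφ.comp (measurable_inv.smul_const x)).aestronglyMeasurable
    (Eventually.of_forall fun g => hC _)

theorem abs_leftAverage_le {k : G → ℝ} (hk : Integrable k haar) {φ : X → ℝ} {C : ℝ}
    (hC : ∀ x, |φ x| ≤ C) (x : X) :
    |leftAverage k φ x| ≤ C * ∫ g, ‖k g‖ ∂haar := by
  rw [← integral_const_mul, ← Real.norm_eq_abs]
  refine norm_integral_le_of_norm_le (hk.norm.const_mul _) (Eventually.of_forall fun g => ?_)
  rw [norm_mul, mul_comm]
  gcongr
  exact hC _

theorem bddMeasurable_leftAverage {k : G → ℝ} (hkm : Measurable k) (hk : Integrable k haar)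
    {φ : X → ℝ} (hφ : BddMeasurable φ) : BddMeasurable (leftAverage k φ) := by
  obtain ⟨hφm, C, hC⟩ := hφ
  refine ⟨?_, _, abs_leftAverage_le hk hC⟩
  have : Measurable fun p : X × G => k p.2 * φ (p.2⁻¹ • p.1) :=
    (hkm.comp measurable_snd).mul (hφm.comp (measurable_snd.inv.smul measurable_fst))
  exact this.stronglyMeasurable.integral_prod_right.measurable

theorem leftAverage_congr {k l : G → ℝ} (h : k =ᵐ[haar] l) (φ : X → ℝ) :
    leftAverage k φ = leftAverage l φ := by
  ext x
  refine integral_congr_ae ?_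
  filter_upwards [h] with g hg
  rw [hg]

/-- Substituting g ↦ t⁻¹g in the Haar integral moves a translation of X onto the density on G. -/
theorem leftAverage_smul (k : G → ℝ) (φ : X → ℝ) (t : G) (x : X) :
    leftAverage k φ (t⁻¹ • x) = leftAverage (fun g => k (t⁻¹ * g)) φ x := by
  unfold leftAverage
  rw [← integral_mul_left_eq_self (fun g => k (t⁻¹ * g) * φ (g⁻¹ • x)) t]
  simp [mul_smul]

/-- A mean invariant under a dense set of translations takes, on the averages of a function over
`G`, a value proportional to the mass of the averaging density. -/
theorem IsMean.exists_leftAverage_eq (hN : IsMean m N) {H : Set G} (hH : Dense H)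
    (hinv : ∀ t ∈ H, ∀ φ, BddMeasurable φ → N (fun x => φ (t⁻¹ • x)) = N φ)
    {φ : X → ℝ} (hφ : BddMeasurable φ) :
    ∃ c, ∀ k : G → ℝ, Measurable k → Integrable k haar →
      N (leftAverage k φ) = c * ∫ g, k g ∂haar := by
  obtain ⟨C, hC⟩ := hφ.2
  have hLm : ∀ k : Lp ℝ 1 (haar : Measure G), Measurable k := fun k =>
    (Lp.stronglyMeasurable k).measurable
  have hLi : ∀ k : Lp ℝ 1 (haar : Measure G), Integrable k haar := L1.integrable_coeFn
  -- Monotonicity of the mean bounds this functional by C‖k‖₁, so it is integration against a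
  -- bounded function on G.
  let Λ : Lp ℝ 1 (haar : Measure G) →L[ℝ] ℝ := LinearMap.mkContinuous
    { toFun := fun k => N (leftAverage k φ)
      map_add' := fun k l => by
        rw [← hN.add (bddMeasurable_leftAverage (hLm k) (hLi k) hφ)
          (bddMeasurable_leftAverage (hLm l) (hLi l) hφ), leftAverage_congr (Lp.coeFn_add k l)]
        congr 1
        ext x
        unfold leftAverage
        rw [← integral_add (integrable_leftAverage (hLi k) hφ x)
          (integrable_leftAverage (hLi l) hφ x)]
        simp [add_mul]
      map_smul' := fun c k => by
        rw [RingHom.id_apply, smul_eq_mul,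
          ← hN.const_mul c (bddMeasurable_leftAverage (hLm k) (hLi k) hφ),
          leftAverage_congr (Lp.coeFn_smul c k)]
        congr 1
        ext x
        unfold leftAverage
        rw [← integral_const_mul]
        simp [mul_assoc] } C fun k => by
      rw [L1.norm_eq_integral_norm]
      exact hN.abs_apply_le (bddMeasurable_leftAverage (hLm k) (hLi k) hφ)
        (abs_leftAverage_le (hLi k) hC)
  obtain ⟨ψ, hψm, hψb, hψ⟩ := exists_bounded_density haar Λ
  have hk : ∀ k : G → ℝ, Integrable k haar → N (leftAverage k φ) = ∫ g, k g * ψ g ∂haar := by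
    intro k hk
    have h : N (leftAverage (hk.toL1 : G → ℝ) φ) = _ := hψ hk.toL1
    rw [leftAverage_congr hk.coeFn_toL1] at h
    rw [h]
    refine integral_congr_ae ?_
    filter_upwards [hk.coeFn_toL1] with g hg
    rw [hg]
  -- Translating the average with density 1_B by t gives the average with density 1_{tB}, so
  -- invariance under `H` equates the integrals of `ψ` over B and tB.
  obtain ⟨c, hc⟩ := ae_eq_const_of_setIntegral_shift hH ⟨hψm, hψb⟩ fun t ht B hBm hB => by
    have hi : ∀ A : Set G, MeasurableSet A → haar A ≠ ∞ →
        N (leftAverage (A.indicator 1) φ) = ∫ g in A, ψ g ∂haar := by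
      intro A hA hA'
      rw [hk (A.indicator 1) ((integrable_indicator_iff hA).2 (integrableOn_const hA')),
        ← integral_indicator hA]
      congr 1
      ext g
      by_cases hg : g ∈ A <;> simp [hg]
    rw [← hi B hBm hB, ← hi _ (measurableSet_shift t hBm) (by rwa [haar_shift]),
      ← hinv t ht (leftAverage (B.indicator 1) φ) (bddMeasurable_leftAverage
        (measurable_one.indicator hBm)
        ((integrable_indicator_iff hBm).2 (integrableOn_const hB)) hφ)]
    congr 1
    ext x
    rw [leftAverage_smul]
    rfl
  refine ⟨c, fun k hkm hki => ?_⟩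
  rw [hk k hki, ← integral_const_mul]
  refine integral_congr_ae ?_
  filter_upwards [hc] with g hg
  rw [hg, mul_comm]

/-- A mean invariant under a dense set of translations takes, on the averages of a function over
`G`, a value proportional to the mass of the averaging measure. -/
theorem IsMean.exists_average_eq (hN : IsMean m N) {H : Set G} (hH : Dense H)
    (hinv : ∀ t ∈ H, ∀ φ, BddMeasurable φ → N (fun x => φ (t⁻¹ • x)) = N φ)
    {φ : X → ℝ} (hφ : BddMeasurable φ) :
    ∃ c, ∀ (ν : Measure G) [IsFiniteMeasure ν], ν ≪ haar →
      N (fun x => ∫ g, φ (g • x) ∂ν) = c * ν.real Set.univ := by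
  obtain ⟨c, hc⟩ := hN.exists_leftAverage_eq hH hinv hφ
  refine ⟨c, fun ν _ hν => ?_⟩
  -- `leftAverage` acts through g⁻¹, hence the image of `ν` under inversion, which has the same mass
  -- and is still absolutely continuous.
  have hac : ν.map Inv.inv ≪ haar :=
    (hν.map measurable_inv).trans (quasiMeasurePreserving_inv haar).absolutelyContinuous
  have hfin : IsFiniteMeasure (ν.map Inv.inv) := isFiniteMeasure_map ν _
  have h := hc (fun g => ((ν.map Inv.inv).rnDeriv haar g).toReal)
    (measurable_rnDeriv _ _).ennreal_toReal integrable_toReal_rnDeriv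
  rw [integral_toReal_rnDeriv hac, map_measureReal_apply measurable_inv MeasurableSet.univ,
    Set.preimage_univ] at h
  rw [← h]
  congr 1
  ext x
  unfold leftAverage
  have h2 := integral_rnDeriv_smul hac (f := fun g : G => φ (g⁻¹ • x))
  simp only [smul_eq_mul] at h2
  rw [h2, integral_map measurable_inv.aemeasurable (f := fun g : G => φ (g⁻¹ • x))
    (hφ.1.comp (measurable_inv.smul_const x)).aestronglyMeasurable]
  simp

end Invariant

end Averaging

/-! ### Convolution of measures on G with measures on X -/

section Convolution

open Measure

variable {G X : Type*} [Group G] [MeasurableSpace G] [MulAction G X] [MeasurableSpace X]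
  [MeasurableSMul₂ G X]

theorem measurable_act : Measurable fun p : G × X => p.1 • p.2 := measurable_smul

/-- The image of `ν × τ` under the action map. -/
noncomputable def actConv (ν : Measure G) (τ : Measure X) : Measure X :=
  (ν.prod τ).map fun p : G × X => p.1 • p.2

instance isFiniteMeasure_actConv (ν : Measure G) (τ : Measure X) [IsFiniteMeasure ν]
    [IsFiniteMeasure τ] : IsFiniteMeasure (actConv ν τ) :=
  isFiniteMeasure_map _ _

theorem actConv_univ (ν : Measure G) (τ : Measure X) [SFinite τ] :
    actConv ν τ Set.univ = ν Set.univ * τ Set.univ := by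
  rw [actConv, map_apply measurable_act MeasurableSet.univ, Set.preimage_univ,
    ← Set.univ_prod_univ, prod_prod]

theorem actConv_ac (m : Measure X) [QuasiInvariant G m] (ν : Measure G) {τ : Measure X}
    [SFinite τ] (hτ : τ ≪ m) : actConv ν τ ≪ m := by
  refine AbsolutelyContinuous.mk fun A hA h0 => ?_
  have hm : Measurable fun p : G × X => p.1 • p.2 := measurable_smul
  rw [actConv, map_apply hm hA, measure_prod_null (hm hA)]
  refine Eventually.of_forall fun g => hτ ?_
  have h := QuasiInvariant.map_ac (m := m) g h0
  rwa [map_apply (measurable_const_smul g) hA] at h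

theorem actConv_add_right (ν : Measure G) [SFinite ν] (τ τ' : Measure X) [SFinite τ] [SFinite τ'] :
    actConv ν (τ + τ') = actConv ν τ + actConv ν τ' := by
  rw [actConv, prod_add, Measure.map_add _ _ measurable_act]
  rfl

theorem actConv_smul_right (ν : Measure G) (τ : Measure X) [SFinite τ] (a : ℝ≥0∞) :
    actConv ν (a • τ) = a • actConv ν τ := by
  rw [actConv, prod_smul_right, Measure.map_smul]
  rfl

theorem actConv_mono_left {ν ν' : Measure G} [SFinite ν] [SFinite ν'] (τ : Measure X) [SFinite τ]
    (h : ν ≤ ν') :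
    actConv ν τ ≤ actConv ν' τ :=
  map_mono (prod_mono h le_rfl) measurable_smul

theorem actConv_add_left (ν ν' : Measure G) [SFinite ν] [SFinite ν'] (τ : Measure X) [SFinite τ] :
    actConv (ν + ν') τ = actConv ν τ + actConv ν' τ := by
  rw [actConv, add_prod, Measure.map_add _ _ measurable_act]
  rfl

/-- Associativity of the action: a translation of ν ∗ τ acts on ν alone. Almost invariance of ν thus
passes to ν ∗ τ uniformly in the probability measure τ. -/
theorem map_smul_actConv [MeasurableMul₂ G] (g : G) (ν : Measure G) (τ : Measure X) [SFinite ν]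
    [SFinite τ] :
    (actConv ν τ).map (fun x => g • x) = actConv (ν.map fun h => g * h) τ := by
  have h1 : ((ν.map fun h => g * h).prod τ) = (ν.prod τ).map (Prod.map (fun h => g * h) id) := by
    rw [← map_prod_map _ _ (measurable_const_mul g) measurable_id, Measure.map_id]
  rw [actConv, actConv, h1, map_map (measurable_const_smul g) measurable_act,
    map_map measurable_act ((measurable_const_mul g).prodMap measurable_id)]
  congr 1
  ext p
  simp [mul_smul]

/-- This adjunction moves the averaging from the measure `τ` to the function `φ`, where a mean can
be applied to it. -/
theorem integral_actConv (ν : Measure G) (τ : Measure X) [IsFiniteMeasure ν] [IsFiniteMeasure τ]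
    {φ : X → ℝ} (hφ : BddMeasurable φ) :
    ∫ x, φ x ∂(actConv ν τ) = ∫ x, ∫ g, φ (g • x) ∂ν ∂τ := by
  rw [actConv, integral_map measurable_act.aemeasurable hφ.1.aestronglyMeasurable]
  obtain ⟨hφm, C, hC⟩ := hφ
  exact integral_prod_symm _ (Integrable.of_bound (C := C)
    (hφm.comp measurable_act).aestronglyMeasurable (Eventually.of_forall fun p => hC _))

theorem bddMeasurable_average (ν : Measure G) [IsFiniteMeasure ν] {φ : X → ℝ}
    (hφ : BddMeasurable φ) : BddMeasurable fun x => ∫ g, φ (g • x) ∂ν := by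
  obtain ⟨hφm, C, hC⟩ := hφ
  have h : Measurable fun p : X × G => φ (p.2 • p.1) :=
    hφm.comp (measurable_snd.smul measurable_fst)
  refine ⟨h.stronglyMeasurable.integral_prod_right.measurable, C * ν.real Set.univ, fun x => ?_⟩
  rw [← Real.norm_eq_abs]
  exact norm_integral_le_of_norm_le_const (Eventually.of_forall fun g => hC (g • x))

end Convolution

/-! ### Densities and their square roots in L² -/

section Density

open Measure

variable {X : Type*} [MeasurableSpace X] (m : Measure X) [SigmaFinite m]

/-- The real-valued Radon–Nikodym density with respect to `m`. -/
noncomputable def realDensity (τ : Measure X) (x : X) : ℝ := (τ.rnDeriv m x).toReal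

theorem integrable_realDensity (τ : Measure X) [IsFiniteMeasure τ] :
    Integrable (realDensity m τ) m := integrable_toReal_rnDeriv

theorem realDensity_nonneg (τ : Measure X) (x : X) : 0 ≤ realDensity m τ x :=
  ENNReal.toReal_nonneg

theorem measurable_realDensity (τ : Measure X) : Measurable (realDensity m τ) :=
  (measurable_rnDeriv _ _).ennreal_toReal

theorem integral_realDensity_mul {τ : Measure X} [IsFiniteMeasure τ] (hτ : τ ≪ m) (φ : X → ℝ) :
    ∫ x, realDensity m τ x * φ x ∂m = ∫ x, φ x ∂τ :=
  integral_rnDeriv_smul hτ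

theorem realDensity_add (τ τ' : Measure X) [IsFiniteMeasure τ] [IsFiniteMeasure τ'] :
    ∀ᵐ x ∂m, realDensity m (τ + τ') x = realDensity m τ x + realDensity m τ' x := by
  filter_upwards [rnDeriv_add τ τ' m, rnDeriv_lt_top τ m, rnDeriv_lt_top τ' m] with x h h1 h2
  simp only [realDensity]
  rw [h, Pi.add_apply, ENNReal.toReal_add h1.ne h2.ne]

theorem realDensity_smul (τ : Measure X) [IsFiniteMeasure τ] {a : ℝ≥0∞} (ha : a ≠ ∞) :
    ∀ᵐ x ∂m, realDensity m (a • τ) x = a.toReal * realDensity m τ x := by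
  filter_upwards [rnDeriv_smul_left_of_ne_top τ m ha] with x h
  simp only [realDensity]
  rw [h, Pi.smul_apply, smul_eq_mul, ENNReal.toReal_mul]

theorem realDensity_mono {τ τ' : Measure X} [IsFiniteMeasure τ] [IsFiniteMeasure τ']
    (hτ : τ ≪ m) (hτ' : τ' ≪ m) (h : τ ≤ τ') :
    ∀ᵐ x ∂m, realDensity m τ x ≤ realDensity m τ' x := by
  refine ae_le_of_forall_setIntegral_le (integrable_realDensity m τ) (integrable_realDensity m τ')
    fun s hs _ => ?_
  simp only [realDensity]
  rw [setIntegral_toReal_rnDeriv hτ, setIntegral_toReal_rnDeriv hτ']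
  exact ENNReal.toReal_mono (measure_ne_top _ _) (h s)

/-- The two dominations say that the densities of `τ` and `τ'` differ pointwise by at most the
density of `σ`, whose integral is the mass of `σ`. -/
theorem integral_abs_realDensity_sub_le {τ τ' σ : Measure X} [IsFiniteMeasure τ]
    [IsFiniteMeasure τ'] [IsFiniteMeasure σ] (hτ : τ ≪ m) (hτ' : τ' ≪ m) (hσ : σ ≪ m)
    (h : τ ≤ τ' + σ) (h' : τ' ≤ τ + σ) :
    ∫ x, |realDensity m τ x - realDensity m τ' x| ∂m ≤ σ.real Set.univ := by
  rw [← integral_toReal_rnDeriv hσ]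
  refine integral_mono_ae ((integrable_realDensity m τ).sub (integrable_realDensity m τ')).abs
    integrable_toReal_rnDeriv ?_
  filter_upwards [realDensity_mono m hτ (hτ'.add_left hσ) h,
    realDensity_mono m hτ' (hτ.add_left hσ) h', realDensity_add m τ' σ, realDensity_add m τ σ]
    with x h1 h2 h3 h4
  rw [h3] at h1
  rw [h4] at h2
  change _ ≤ realDensity m σ x
  rw [abs_le]
  constructor <;> linarith

theorem memLp_sqrt_realDensity (τ : Measure X) [IsFiniteMeasure τ] :
    MemLp (fun x => (Real.sqrt (realDensity m τ x) : ℂ)) 2 m := by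
  have hm : Measurable fun x => Real.sqrt (realDensity m τ x) := (measurable_realDensity m τ).sqrt
  have h : MemLp (fun x => Real.sqrt (realDensity m τ x)) 2 m := by
    rw [memLp_two_iff_integrable_sq hm.aestronglyMeasurable]
    simpa only [Real.sq_sqrt (realDensity_nonneg m τ _)] using integrable_realDensity m τ
  exact h.ofReal

/-- The square root of the density of a measure, as a vector of `L²`. -/
noncomputable def rootVector (τ : Measure X) [IsFiniteMeasure τ] : Lp ℂ 2 m :=
  (memLp_sqrt_realDensity m τ).toLp

theorem rootVector_ae (τ : Measure X) [IsFiniteMeasure τ] :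
    rootVector m τ =ᵐ[m] fun x => (Real.sqrt (realDensity m τ x) : ℂ) :=
  (memLp_sqrt_realDensity m τ).coeFn_toLp

theorem norm_sq_eq_integral (f : Lp ℂ 2 m) : ‖f‖ ^ 2 = ∫ x, ‖f x‖ ^ 2 ∂m := by
  have h : inner ℂ f f = ((∫ x, ‖f x‖ ^ 2 ∂m : ℝ) : ℂ) := by
    rw [L2.inner_def, ← integral_complex_ofReal]
    refine integral_congr_ae (Eventually.of_forall fun x => ?_)
    simp only [inner_self_eq_norm_sq_to_K]
    simp
  rw [inner_self_eq_norm_sq_to_K] at h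
  exact Complex.ofReal_injective (by simpa using h)

theorem norm_rootVector_sq {τ : Measure X} [IsFiniteMeasure τ] (hτ : τ ≪ m) :
    ‖rootVector m τ‖ ^ 2 = τ.real Set.univ := by
  rw [norm_sq_eq_integral, ← integral_toReal_rnDeriv hτ]
  refine integral_congr_ae ?_
  filter_upwards [rootVector_ae m τ] with x hx
  rw [hx, Complex.norm_real, Real.norm_eq_abs, sq_abs, Real.sq_sqrt (realDensity_nonneg m τ x)]
  rfl

/-- Pointwise, (√p - √q)² ≤ |p - q|. This is the passage from almost invariance in L¹ to almost
invariance in L². -/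
theorem norm_rootVector_sub_sq_le (τ τ' : Measure X) [IsFiniteMeasure τ] [IsFiniteMeasure τ'] :
    ‖rootVector m τ - rootVector m τ'‖ ^ 2
      ≤ ∫ x, |realDensity m τ x - realDensity m τ' x| ∂m := by
  rw [norm_sq_eq_integral]
  refine integral_mono_of_nonneg (Eventually.of_forall fun x => by positivity)
    ((integrable_realDensity m τ).sub (integrable_realDensity m τ')).abs ?_
  filter_upwards [rootVector_ae m τ, rootVector_ae m τ', Lp.coeFn_sub (rootVector m τ)
    (rootVector m τ')] with x h1 h2 h3
  rw [h3, Pi.sub_apply, h1, h2, ← Complex.ofReal_sub, Complex.norm_real, Real.norm_eq_abs, sq_abs]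
  refine sq_sqrt_sub_le (realDensity_nonneg _ _ _) (realDensity_nonneg _ _ _) ?_ ?_
  · linarith [le_abs_self (realDensity m τ x - realDensity m τ' x)]
  · linarith [neg_abs_le (realDensity m τ x - realDensity m τ' x)]

end Density

/-! ### The Koopman representation on square roots of densities -/

section Translation

open Measure

variable {G X : Type*} [Group G] [MeasurableSpace G] [MulAction G X] [MeasurableSpace X]
  [MeasurableSMul₂ G X] (m : Measure X) [SigmaFinite m] [QuasiInvariant G m]

/-- The density of gτ at x is d(gm)/dm(x) times the density of τ at g⁻¹x, and taking square roots
gives the Koopman formula. The image is a separate variable `τ'` so that it may be written in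
another form, such as a convolution. -/
theorem koopmanHom_rootVector (g : G) {τ : Measure X} [IsFiniteMeasure τ] (hτ : τ ≪ m)
    {τ' : Measure X} [IsFiniteMeasure τ'] (h : τ.map (fun x => g • x) = τ') :
    koopmanHom m g (rootVector m τ) = rootVector m τ' := by
  subst h
  ext1
  refine (koopmanIsometry_ae m g (rootVector m τ)).trans ?_
  filter_upwards [ae_smul m g⁻¹ (rootVector_ae m τ),
    rootVector_ae m (τ.map (fun x => g • x)), rnDeriv_map_smul m g hτ] with x h1 h2 h3
  rw [koopmanFun, h1, h2, realDensity, realDensity, h3, ENNReal.toReal_mul,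
    Real.sqrt_mul ENNReal.toReal_nonneg, Complex.ofReal_mul]

end Translation

/-! ### From invariant means to almost invariant vectors -/

section Reiter

open Measure

variable {G X : Type*} [Group G] [TopologicalSpace G] [IsTopologicalGroup G]
  [LocallyCompactSpace G] [SecondCountableTopology G] [T2Space G]
  [MeasurableSpace G] [BorelSpace G] [MulAction G X] [MeasurableSpace X]
  [MeasurableSMul₂ G X] {m : Measure X} [SigmaFinite m] [QuasiInvariant G m]

/-- Take for `τ` the normalized restriction of m to a subset of {ψ < u} of positive finite measure;
such a subset exists by σ-finiteness. -/
theorem exists_isProbabilityMeasure_integral_lt {ψ : X → ℝ} (hψ : BddMeasurable ψ) {u : ℝ}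
    (h : ¬ ∀ᵐ x ∂m, u ≤ ψ x) :
    ∃ τ : Measure X, IsProbabilityMeasure τ ∧ τ ≪ m ∧ ∫ x, ψ x ∂τ < u := by
  have hA : MeasurableSet {x | ψ x < u} := measurableSet_lt hψ.1 measurable_const
  have hpos : 0 < m {x | ψ x < u} := by
    rw [ae_iff] at h
    simpa [pos_iff_ne_zero] using h
  obtain ⟨B, hB, hBA, hB0, hB'⟩ := exists_subset_measure_lt_top (μ := m) hA hpos
  have hBne : m B ≠ 0 := hB0.ne'
  refine ⟨ProbabilityTheory.cond m B, ProbabilityTheory.cond_isProbabilityMeasure_of_finite hBne hB'.ne,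
    ProbabilityTheory.cond_absolutelyContinuous, ?_⟩
  have hp := ProbabilityTheory.cond_isProbabilityMeasure_of_finite hBne hB'.ne
  have hlt : ∀ᵐ x ∂(ProbabilityTheory.cond m B), ψ x < u := by
    filter_upwards [ProbabilityTheory.ae_cond_mem hB] with x hx using hBA hx
  have h1 : 0 < ∫ x, ((fun _ : X => u) - ψ) x ∂(ProbabilityTheory.cond m B) := by
    rw [integral_pos_iff_support_of_nonneg_ae (hlt.mono fun x hx => by
      simp only [Pi.zero_apply, Pi.sub_apply]
      linarith)
      ((integrable_const u).sub (hψ.integrable _))]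
    have : (Function.support ((fun _ : X => u) - ψ)) ∈ ae (ProbabilityTheory.cond m B) :=
      hlt.mono fun x hx => by simp [sub_ne_zero, hx.ne']
    rw [(prob_compl_eq_zero_iff₀ ?_).1 this]
    · exact one_pos
    · exact (measurableSet_support (measurable_const.sub hψ.1)).nullMeasurableSet
  rw [integral_sub' (integrable_const u) (hψ.integrable _)] at h1
  simpa using h1

/-- A mean invariant under a dense set of translations yields, by a separation argument, probability
densities whose averages over `G` are almost invariant in `L¹` under finitely many translations. -/
theorem IsMean.exists_almost_invariant {N : (X → ℝ) → ℝ} (hN : IsMean m N) {H : Set G}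
    (hH : Dense H) (hinv : ∀ t ∈ H, ∀ φ, BddMeasurable φ → N (fun x => φ (t⁻¹ • x)) = N φ)
    (ν : Measure G) [IsFiniteMeasure ν] (hν : ν ≪ haar) (F : Finset G) {ε : ℝ} (hε : 0 < ε) :
    ∃ τ : Measure X, ∃ _ : IsProbabilityMeasure τ, τ ≪ m ∧ ∀ s ∈ F,
      ∫ x, |realDensity m (actConv (ν.map fun h => s * h) τ) x
        - realDensity m (actConv ν τ) x| ∂m < ε := by
  classical
  have hνs : ∀ s : G, IsFiniteMeasure (ν.map fun h => s * h) := fun s => isFiniteMeasure_map _ _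
  -- The tuples, indexed by s ∈ F, of density differences between s(ν ∗ τ) and ν ∗ τ. These are
  -- affine in τ, so `D` is convex; if the claim fails, `D` misses the open ball of radius ε.
  let D : Set (F → Lp ℝ 1 m) := {v | ∃ τ : Measure X, ∃ _ : IsProbabilityMeasure τ, τ ≪ m ∧
    ∀ s : F, v s =ᵐ[m] fun x => realDensity m (actConv (ν.map fun h => (s : G) * h) τ) x
      - realDensity m (actConv ν τ) x}
  by_contra hcon
  push Not at hcon
  have hdisj : Disjoint (Metric.ball (0 : F → Lp ℝ 1 m) ε) D := by
    rw [Set.disjoint_left]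
    rintro v hv ⟨τ, hτp, hτ, hvτ⟩
    obtain ⟨s, hs, hle⟩ := hcon τ hτp hτ
    have h1 : ‖v ⟨s, hs⟩‖ < ε := (norm_le_pi_norm v _).trans_lt (by simpa using hv)
    rw [L1.norm_eq_integral_norm] at h1
    refine absurd h1 (not_lt.2 (hle.trans (le_of_eq (integral_congr_ae ?_))))
    filter_upwards [hvτ ⟨s, hs⟩] with x hx
    rw [hx, Real.norm_eq_abs]
  have hconv : Convex ℝ D := by
    rintro v ⟨τ, hτp, hτ, hvτ⟩ w ⟨τ', hτp', hτ', hwτ⟩ a b ha hb hab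
    have key : ∀ (κ : Measure G) [IsFiniteMeasure κ], ∀ᵐ x ∂m,
        realDensity m (actConv κ (ENNReal.ofReal a • τ + ENNReal.ofReal b • τ')) x
          = a * realDensity m (actConv κ τ) x + b * realDensity m (actConv κ τ') x := by
      intro κ _
      have i1 := Measure.smul_finite (actConv κ τ) (ENNReal.ofReal_ne_top (r := a))
      have i2 := Measure.smul_finite (actConv κ τ') (ENNReal.ofReal_ne_top (r := b))
      rw [actConv_add_right, actConv_smul_right, actConv_smul_right]
      filter_upwards [realDensity_add m (ENNReal.ofReal a • actConv κ τ)
        (ENNReal.ofReal b • actConv κ τ'), realDensity_smul m (actConv κ τ)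
        (ENNReal.ofReal_ne_top (r := a)), realDensity_smul m (actConv κ τ')
        (ENNReal.ofReal_ne_top (r := b))] with x h1 h2 h3
      rw [h1, h2, h3, ENNReal.toReal_ofReal ha, ENNReal.toReal_ofReal hb]
    refine ⟨ENNReal.ofReal a • τ + ENNReal.ofReal b • τ', ⟨?_⟩, ?_, fun s => ?_⟩
    · simp [← ENNReal.ofReal_add ha hb, hab]
    · exact (hτ.smul_left _).add_left (hτ'.smul_left _)
    · filter_upwards [Lp.coeFn_add (a • v s) (b • w s), Lp.coeFn_smul a (v s),
        Lp.coeFn_smul b (w s), hvτ s, hwτ s, key ν, key (ν.map fun h => (s : G) * h)]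
        with x h1 h2 h3 h4 h5 h6 h7
      rw [Pi.add_apply, Pi.smul_apply, Pi.smul_apply, h1, Pi.add_apply, h2, h3, h6, h7,
        Pi.smul_apply, Pi.smul_apply, h4, h5, smul_eq_mul, smul_eq_mul]
      ring
  -- The separating functional satisfies f < u on the ball and f ≥ u on `D`. As the ball contains 0,
  -- u is positive.
  obtain ⟨f, u, hball, hD⟩ := geometric_hahn_banach_open (convex_ball 0 ε) Metric.isOpen_ball
    hconv hdisj
  have hu : 0 < u := by simpa using hball 0 (Metric.mem_ball_self hε)
  choose ψ hψm hψb hψ using fun s : F =>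
    exists_bounded_density m (f.comp (ContinuousLinearMap.single ℝ (fun _ : F => Lp ℝ 1 m) s))
  have hψB : ∀ s, BddMeasurable (ψ s) := fun s => ⟨hψm s, hψb s⟩
  have hf : ∀ v : F → Lp ℝ 1 m, f v = ∑ s, ∫ x, v s x * ψ s x ∂m := by
    intro v
    simp only [← hψ]
    conv_lhs => rw [← Finset.univ_sum_single v, _root_.map_sum]
    rfl
  -- By adjunction, `f` at the tuple attached to τ equals ∫ ∑ Φ_s dτ.
  let Φ : F → X → ℝ := fun s x =>
    (∫ g, ψ s (g • x) ∂(ν.map fun h => (s : G) * h)) - ∫ g, ψ s (g • x) ∂ν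
  have hΦB : ∀ s, BddMeasurable (Φ s) := fun s =>
    (bddMeasurable_average _ (hψB s)).sub (bddMeasurable_average _ (hψB s))
  have hsum : BddMeasurable fun x => ∑ s, Φ s x := BddMeasurable.finsetSum _ hΦB
  -- The lower bound holds for every probability measure τ ≪ m, hence pointwise almost everywhere.
  have hge : ∀ᵐ x ∂m, u ≤ ∑ s, Φ s x := by
    by_contra hlt
    obtain ⟨τ, hτp, hτ, hlt⟩ := exists_isProbabilityMeasure_integral_lt hsum hlt
    have hi : ∀ s : F, Integrable (fun x => realDensity m (actConv (ν.map fun h => (s : G) * h) τ) x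
      - realDensity m (actConv ν τ) x) m := fun s =>
      (integrable_realDensity m _).sub (integrable_realDensity m _)
    have h1 := hD (fun s => (hi s).toL1) ⟨τ, hτp, hτ, fun s => (hi s).coeFn_toL1⟩
    refine absurd h1 (not_le.2 (lt_of_eq_of_lt ?_ hlt))
    rw [hf, integral_finsetSum _ fun s _ => (hΦB s).integrable τ]
    refine Finset.sum_congr rfl fun s _ => ?_
    rw [integral_sub ((bddMeasurable_average _ (hψB s)).integrable τ)
      ((bddMeasurable_average _ (hψB s)).integrable τ), ← integral_actConv _ _ (hψB s),
      ← integral_actConv _ _ (hψB s), ← integral_realDensity_mul m (actConv_ac m _ hτ),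
      ← integral_realDensity_mul m (actConv_ac m _ hτ), ← integral_sub]
    · refine integral_congr_ae ?_
      filter_upwards [(hi s).coeFn_toL1] with x hx
      rw [hx, sub_mul]
    · obtain ⟨C, hC⟩ := hψb s
      exact (integrable_realDensity m _).mul_bdd (hψm s).aestronglyMeasurable
        (Eventually.of_forall hC)
    · obtain ⟨C, hC⟩ := hψb s
      exact (integrable_realDensity m _).mul_bdd (hψm s).aestronglyMeasurable
        (Eventually.of_forall hC)
  -- The measure `ν` and its translate by s are absolutely continuous of equal mass, so the mean
  -- does not distinguish the two averages in `Φ s`. Hence u ≤ N(∑ Φ_s) = 0, against u > 0.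
  have h0 : N (fun x => ∑ s, Φ s x) = 0 := by
    rw [hN.finsetSum _ hΦB]
    refine Finset.sum_eq_zero fun s _ => ?_
    obtain ⟨c, hc⟩ := hN.exists_average_eq hH hinv (hψB s)
    have hac : (ν.map fun h => (s : G) * h) ≪ haar := by
      have h := hν.map (measurable_const_mul (s : G))
      rwa [map_mul_left_eq_self haar] at h
    rw [hN.sub (bddMeasurable_average _ (hψB s)) (bddMeasurable_average _ (hψB s)), hc _ hν,
      hc _ hac, map_measureReal_apply (measurable_const_mul _) MeasurableSet.univ,
      Set.preimage_univ, sub_self]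
  have h2 := hN.mono (bddMeasurable_const u) hsum hge
  rw [hN.const, h0] at h2
  linarith

theorem map_mul_left_restrict_haar (g : G) {B : Set G} (hB : MeasurableSet B) :
    ((haar : Measure G).restrict B).map (fun h => g * h) = haar.restrict (shift g B) := by
  have h := (measurePreserving_mul_left (haar : Measure G) g).restrict_preimage
    (measurableSet_shift g hB)
  have e : (fun h => g * h) ⁻¹' shift g B = B := by ext; simp [shift]
  rw [e] at h
  exact h.map_eq

theorem restrict_le_add_symmDiff (μ : Measure G) (B B' : Set G) :
    μ.restrict B ≤ μ.restrict B' + μ.restrict (symmDiff B B') := by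
  refine (restrict_mono_set μ ?_).trans (restrict_union_le B' (symmDiff B B'))
  intro h hh
  by_cases h2 : h ∈ B'
  · exact Or.inl h2
  · exact Or.inr (Or.inl ⟨hh, h2⟩)

/-- A mean invariant under a dense set of translations yields vectors of `L²` that are almost
invariant uniformly on compact sets. -/
theorem IsMean.exists_almost_invariant_vector {N : (X → ℝ) → ℝ} (hN : IsMean m N) {H : Set G}
    (hH : Dense H) (hinv : ∀ t ∈ H, ∀ φ, BddMeasurable φ → N (fun x => φ (t⁻¹ • x)) = N φ)
    {Q : Set G} (hQ : IsCompact Q) {ε : ℝ} (hε : 0 < ε) :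
    ∃ ξ : Lp ℂ 2 m, ξ ≠ 0 ∧ ∀ s ∈ Q, ‖koopmanHom m s ξ - ξ‖ ≤ ε * ‖ξ‖ := by
  obtain ⟨K⟩ : Nonempty (TopologicalSpace.PositiveCompacts G) := inferInstance
  have hKm : MeasurableSet (K : Set G) := K.isCompact.measurableSet
  have hK : haar (K : Set G) ≠ ∞ := K.isCompact.measure_ne_top
  have hK0 : 0 < haar (K : Set G) := measure_pos_of_nonempty_interior _ K.interior_nonempty
  set B : Set G := (K : Set G)
  have hB0 : 0 < (haar : Measure G).real B := ENNReal.toReal_pos hK0.ne' hK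
  have hfin : IsFiniteMeasure ((haar : Measure G).restrict B) :=
    ⟨by rw [restrict_apply_univ]; exact hK.lt_top⟩
  -- The vector used below has squared norm λ(B), so an L¹-error of δ gives an L²-error of at most
  -- ε/2 times the norm.
  set δ : ℝ := (ε / 2) ^ 2 * (haar : Measure G).real B with hδ
  have hδ0 : 0 < δ := by positivity
  -- Elements of `V` move λ|_B, and hence (λ|_B) ∗ τ, by at most δ in L¹ for every probability
  -- measure τ. So `V` can be fixed before τ, and finitely many translates tV cover Q.
  let V : Set G := {v | (haar : Measure G).real (symmDiff (shift v B) B) ≤ δ}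
  have hV : V ∈ 𝓝 (1 : G) := by
    have h := (ENNReal.tendsto_toReal ENNReal.zero_ne_top).comp (tendsto_haar_shift hKm hK)
    exact (h.eventually (gt_mem_nhds (by simpa using hδ0))).mono fun v hv => le_of_lt hv
  obtain ⟨F, -, hF⟩ := hQ.elim_nhds_subcover (fun s : G => (fun h => s⁻¹ * h) ⁻¹' V) fun s _ => by
    have : Continuous fun h : G => s⁻¹ * h := by fun_prop
    exact this.continuousAt.preimage_mem_nhds (by simpa using hV)
  obtain ⟨τ, hτp, hτ, hFτ⟩ := hN.exists_almost_invariant hH hinv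
    ((haar : Measure G).restrict B) restrict_le_self.absolutelyContinuous F hδ0
  set ν := (haar : Measure G).restrict B with hν
  have hac : actConv ν τ ≪ m := actConv_ac m _ hτ
  have hνs : ∀ s : G, IsFiniteMeasure (ν.map fun h => s * h) := fun s => isFiniteMeasure_map _ _
  have hnorm : ‖rootVector m (actConv ν τ)‖ ^ 2 = (haar : Measure G).real B := by
    rw [norm_rootVector_sq m hac, measureReal_def, actConv_univ]
    simp [hν, measureReal_def]
  have hstep : ∀ g : G, ∫ x, |realDensity m (actConv (ν.map fun h => g * h) τ) x
        - realDensity m (actConv ν τ) x| ∂m ≤ δ →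
      ‖koopmanHom m g (rootVector m (actConv ν τ)) - rootVector m (actConv ν τ)‖
        ≤ ε / 2 * ‖rootVector m (actConv ν τ)‖ := by
    intro g hg
    rw [koopmanHom_rootVector m g hac (map_smul_actConv g ν τ)]
    refine le_of_sq_le_sq ?_ (by positivity)
    rw [mul_pow, hnorm]
    exact (norm_rootVector_sub_sq_le m _ _).trans hg
  refine ⟨rootVector m (actConv ν τ), ?_, fun s hs => ?_⟩
  · rintro h0
    rw [h0] at hnorm
    simp at hnorm
    linarith
  obtain ⟨t, htF, hts⟩ := Set.mem_iUnion₂.1 (hF hs)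
  have h1 := hstep t (hFτ t htF).le
  -- Write s = t(t⁻¹s): the choice of τ handles t ∈ F, and t⁻¹s lies in `V`. Each factor costs ε/2.
  have h2 := hstep (t⁻¹ * s) <| by
    have hfin' : IsFiniteMeasure ((haar : Measure G).restrict
        (symmDiff (shift (t⁻¹ * s) B) B)) :=
      ⟨by
        rw [restrict_apply_univ]
        exact (measure_symmDiff_ne_top (by rwa [haar_shift]) hK).lt_top⟩
    have hmap : (ν.map fun h => t⁻¹ * s * h) = haar.restrict (shift (t⁻¹ * s) B) :=
      map_mul_left_restrict_haar _ hKm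
    have hfin'' := hνs (t⁻¹ * s)
    rw [hmap] at hfin''
    rw [hmap]
    refine (integral_abs_realDensity_sub_le m
      (σ := actConv ((haar : Measure G).restrict (symmDiff (shift (t⁻¹ * s) B) B)) τ)
      (actConv_ac m _ hτ) hac (actConv_ac m _ hτ) ?_ ?_).trans ?_
    · rw [← actConv_add_left]
      exact actConv_mono_left τ (restrict_le_add_symmDiff _ _ _)
    · rw [← actConv_add_left, symmDiff_comm]
      exact actConv_mono_left τ (restrict_le_add_symmDiff _ _ _)
    · rw [measureReal_def, actConv_univ]
      have hts' : (haar : Measure G).real (symmDiff (shift (t⁻¹ * s) B) B) ≤ δ := hts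
      simpa [measureReal_def] using hts'
  set ξ := rootVector m (actConv ν τ)
  have e : koopmanHom m s ξ = koopmanHom m t (koopmanHom m (t⁻¹ * s) ξ) := by
    have := map_mul (koopmanHom (G := G) m) t (t⁻¹ * s)
    rw [mul_inv_cancel_left] at this
    rw [this]
    rfl
  calc ‖koopmanHom m s ξ - ξ‖
      = ‖koopmanHom m t (koopmanHom m (t⁻¹ * s) ξ - ξ) + (koopmanHom m t ξ - ξ)‖ := by
        rw [e, map_sub]; congr 1; abel
    _ ≤ ‖koopmanHom m (t⁻¹ * s) ξ - ξ‖ + ‖koopmanHom m t ξ - ξ‖ := by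
        refine (norm_add_le _ _).trans ?_
        rw [LinearIsometryEquiv.norm_map]
    _ ≤ ε * ‖ξ‖ := by linarith

end Reiter

/-! ### Restriction of invariant means to real functions -/

section InvariantMean

variable {G X : Type*} [Group G] [MeasurableSpace G] [MulAction G X] [MeasurableSpace X]
  [MeasurableSMul₂ G X] (m : Measure X) [QuasiInvariant G m]

open scoped ComplexOrder in
/-- There is a mean on `L^∞(X, m)` that is invariant under the translations by elements of `H`. -/
def HasInvariantMean (H : Set G) : Prop :=
  ∃ M : Lp ℂ ∞ m →ₗ[ℂ] ℂ,
    (∀ φ : Lp ℂ ∞ m, (∀ᵐ x ∂m, 0 ≤ φ x) → 0 ≤ M φ) ∧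
    M (memLp_top_const (1 : ℂ)).toLp = 1 ∧
    ∀ g ∈ H, ∀ φ : Lp ℂ ∞ m, M (translate m g φ) = M φ

theorem isCoamenable_iff_hasInvariantMean_univ :
    IsCoamenable G m ↔ HasInvariantMean m (Set.univ : Set G) := by
  simp [IsCoamenable, HasInvariantMean]

variable {m}

theorem BddMeasurable.memLp_ofReal {φ : X → ℝ} (hφ : BddMeasurable φ) :
    MemLp (fun x => (φ x : ℂ)) ∞ m := by
  obtain ⟨hφ, C, hC⟩ := hφ
  refine memLp_top_of_bound (Complex.measurable_ofReal.comp hφ).aestronglyMeasurable C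
    (Eventually.of_forall fun x => ?_)
  rw [Complex.norm_real]
  exact hC x

open Classical in
/-- The restriction of a functional on `L^∞` to real functions. -/
noncomputable def realMean (M : Lp ℂ ∞ m →ₗ[ℂ] ℂ) (φ : X → ℝ) : ℝ :=
  if h : MemLp (fun x => (φ x : ℂ)) ∞ m then (M h.toLp).re else 0

theorem realMean_eq (M : Lp ℂ ∞ m →ₗ[ℂ] ℂ) {φ : X → ℝ} (h : MemLp (fun x => (φ x : ℂ)) ∞ m) :
    realMean M φ = (M h.toLp).re := dif_pos h

theorem realMean_add (M : Lp ℂ ∞ m →ₗ[ℂ] ℂ) {φ ψ : X → ℝ} (hφ : BddMeasurable φ)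
    (hψ : BddMeasurable ψ) : realMean M (fun x => φ x + ψ x) = realMean M φ + realMean M ψ := by
  rw [realMean_eq M hφ.memLp_ofReal, realMean_eq M hψ.memLp_ofReal,
    realMean_eq M (hφ.add hψ).memLp_ofReal, ← Complex.add_re, ← map_add, ← MemLp.toLp_add]
  congr 3
  ext x
  simp

theorem realMean_const_mul (M : Lp ℂ ∞ m →ₗ[ℂ] ℂ) (c : ℝ) {φ : X → ℝ} (hφ : BddMeasurable φ) :
    realMean M (fun x => c * φ x) = c * realMean M φ := by
  rw [realMean_eq M hφ.memLp_ofReal, realMean_eq M (hφ.const_mul c).memLp_ofReal,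
    ← Complex.re_ofReal_mul, ← smul_eq_mul, ← map_smul, ← MemLp.toLp_const_smul]
  congr 3
  ext x
  simp

open scoped ComplexOrder in
theorem isMean_realMean {M : Lp ℂ ∞ m →ₗ[ℂ] ℂ}
    (hpos : ∀ φ : Lp ℂ ∞ m, (∀ᵐ x ∂m, 0 ≤ φ x) → 0 ≤ M φ)
    (hone : M (memLp_top_const (1 : ℂ)).toLp = 1) : IsMean m (realMean M) where
  add hφ hψ := realMean_add M hφ hψ
  const_mul c _ hφ := realMean_const_mul M c hφ
  mono {φ ψ} hφ hψ h := by
    have h1 : BddMeasurable fun x => ψ x + -1 * φ x := hψ.add (hφ.const_mul (-1))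
    have h2 : 0 ≤ realMean M fun x => ψ x + -1 * φ x := by
      rw [realMean_eq M h1.memLp_ofReal]
      refine (Complex.le_def.1 (hpos _ ?_)).1
      filter_upwards [h1.memLp_ofReal.coeFn_toLp, h] with x hx hx'
      rw [hx, Complex.zero_le_real]
      linarith
    rw [realMean_add M hψ (hφ.const_mul (-1)), realMean_const_mul M _ hφ] at h2
    linarith
  one := by
    rw [realMean_eq M (bddMeasurable_const 1).memLp_ofReal]
    have e : (bddMeasurable_const (X := X) 1).memLp_ofReal.toLp
        = (memLp_top_const (1 : ℂ) : MemLp (fun _ : X => (1 : ℂ)) ∞ m).toLp := by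
      congr 1
    rw [e, hone, Complex.one_re]

theorem realMean_smul {M : Lp ℂ ∞ m →ₗ[ℂ] ℂ} {g : G}
    (hg : ∀ φ : Lp ℂ ∞ m, M (translate m g φ) = M φ) {φ : X → ℝ} (hφ : BddMeasurable φ) :
    realMean M (fun x => φ (g⁻¹ • x)) = realMean M φ := by
  have hφg : BddMeasurable fun x => φ (g⁻¹ • x) := by
    obtain ⟨hφ, C, hC⟩ := hφ
    exact ⟨hφ.comp (measurable_const_smul g⁻¹), C, fun x => hC _⟩
  rw [realMean_eq M hφ.memLp_ofReal, realMean_eq M hφg.memLp_ofReal,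
    ← hg hφ.memLp_ofReal.toLp]
  congr 2
  ext1
  have hq : Measure.QuasiMeasurePreserving (fun x : X => g⁻¹ • x) m m :=
    ⟨measurable_const_smul g⁻¹, QuasiInvariant.map_ac g⁻¹⟩
  filter_upwards [hφg.memLp_ofReal.coeFn_toLp,
    (memLp_top_smul m g hφ.memLp_ofReal.toLp).coeFn_toLp,
    hq.ae (hφ.memLp_ofReal.coeFn_toLp)] with x h1 h2 h3
  rw [h1, translate, h2, h3]

end InvariantMean

/-! ### Spectral gap and almost invariant vectors -/

section SpectralGap

theorem UnitaryRep.not_hasSpectralGapProperty {G H : Type*} [Group G] [TopologicalSpace G]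
    [NormedAddCommGroup H] [InnerProductSpace ℂ H] (π : UnitaryRep G H)
    (h : ∀ Q : Set G, IsCompact Q → ∀ ε : ℝ, 0 < ε →
      ∃ ξ : H, ξ ≠ 0 ∧ ∀ s ∈ Q, ‖π.toHom s ξ - ξ‖ ≤ ε * ‖ξ‖) :
    ¬ π.HasSpectralGapProperty := by
  rintro ⟨Q, hQ, ε, hε, hgap⟩
  obtain ⟨ξ, hξ, hs⟩ := h Q hQ (ε / 2) (by positivity)
  have h1 := hgap ξ
  -- The bound also covers empty Q, where the real supremum is 0.
  have h2 : ⨆ s : Q, ‖π.toHom s ξ - ξ‖ ≤ ε / 2 * ‖ξ‖ :=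
    Real.iSup_le (fun s => hs s s.2) (by positivity)
  have h3 : 0 < ‖ξ‖ := norm_pos_iff.2 hξ
  nlinarith

/-- Without spectral gap there is a sequence of almost invariant unit vectors. -/
theorem UnitaryRep.exists_almost_invariant_seq {G H : Type*} [Group G] [TopologicalSpace G]
    [SigmaCompactSpace G] [NormedAddCommGroup H] [InnerProductSpace ℂ H] (π : UnitaryRep G H)
    (h : ¬ π.HasSpectralGapProperty) :
    ∃ η : ℕ → H, (∀ n, ‖η n‖ = 1) ∧
      ∀ g, Tendsto (fun n => ‖π.toHom g (η n) - η n‖) atTop (𝓝 0) := by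
  -- The n-th set of an increasing compact cover is paired with ε = 1/(n+1), so each g is controlled
  -- for all large n.
  have key : ∀ n : ℕ, ∃ η : H, ‖η‖ = 1 ∧
      ∀ s ∈ compactCovering G n, ‖π.toHom s η - η‖ ≤ 1 / ((n : ℝ) + 1) := by
    intro n
    by_contra hcon
    refine h ⟨compactCovering G n, isCompact_compactCovering G n, 1 / ((n : ℝ) + 1),
      by positivity, fun ξ => ?_⟩
    by_contra hlt
    rw [not_le] at hlt
    have hξ : ξ ≠ 0 := by
      rintro rfl
      simp at hlt
    have hξ' : 0 < ‖ξ‖ := norm_pos_iff.2 hξ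
    refine hcon ⟨((‖ξ‖⁻¹ : ℝ) : ℂ) • ξ, ?_, fun s hs => ?_⟩
    · rw [norm_smul, Complex.norm_real, Real.norm_of_nonneg (by positivity)]
      field_simp
    -- A real supremum dominates its terms only when the family is bounded, here by 2‖ξ‖.
    · have hb : BddAbove (Set.range fun s : compactCovering G n => ‖π.toHom s ξ - ξ‖) := by
        refine ⟨‖ξ‖ + ‖ξ‖, ?_⟩
        rintro _ ⟨t, rfl⟩
        refine (norm_sub_le _ _).trans ?_
        rw [LinearIsometryEquiv.norm_map]
      have h1 := (le_ciSup hb ⟨s, hs⟩).trans hlt.le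
      rw [map_smul, ← smul_sub, norm_smul, Complex.norm_real,
        Real.norm_of_nonneg (by positivity), inv_mul_le_iff₀ hξ', mul_comm]
      exact h1
  choose η hη hs using key
  refine ⟨η, hη, fun g => ?_⟩
  obtain ⟨N, hN⟩ := Set.mem_iUnion.1 (by rw [iUnion_compactCovering]; trivial :
    g ∈ ⋃ n, compactCovering G n)
  refine squeeze_zero' (Eventually.of_forall fun _ => norm_nonneg _) ?_
    tendsto_one_div_add_atTop_nhds_zero_nat
  filter_upwards [eventually_ge_atTop N] with n hn
  exact hs n g (compactCovering_subset G hn hN)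

end SpectralGap

/-! ### From almost invariant vectors to invariant means -/

section MeanToVectors

variable {G X : Type*} [Group G] [TopologicalSpace G] [IsTopologicalGroup G]
  [LocallyCompactSpace G] [SecondCountableTopology G] [T2Space G]
  [MeasurableSpace G] [BorelSpace G] [MulAction G X] [MeasurableSpace X]
  [MeasurableSMul₂ G X] {m : Measure X} [SigmaFinite m] [QuasiInvariant G m]

/-- A mean invariant under a dense set of translations excludes the Spectral Gap Property. -/
theorem HasInvariantMean.not_hasSpectralGapProperty {H : Set G} (hM : HasInvariantMean m H)
    (hH : Dense H) : ¬ (koopmanRep G m).HasSpectralGapProperty := by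
  obtain ⟨M, hpos, hone, hinv⟩ := hM
  exact UnitaryRep.not_hasSpectralGapProperty _ fun Q hQ ε hε =>
    (isMean_realMean hpos hone).exists_almost_invariant_vector hH
      (fun t ht φ hφ => realMean_smul (hinv t ht) hφ) hQ hε

/-- The quadratic form `∫ φ |ξ|² dm`. -/
noncomputable def vectorState (m : Measure X) (ξ : Lp ℂ 2 m) (φ : Lp ℂ ∞ m) : ℂ :=
  ∫ x, φ x * ((‖ξ x‖ ^ 2 : ℝ) : ℂ) ∂m

theorem integrable_norm_sq (ξ : Lp ℂ 2 m) : Integrable (fun x => ‖ξ x‖ ^ 2) m :=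
  (memLp_two_iff_integrable_sq_norm (Lp.aestronglyMeasurable ξ)).1 (Lp.memLp ξ)

theorem ae_norm_le_norm_top (φ : Lp ℂ ∞ m) : ∀ᵐ x ∂m, ‖φ x‖ ≤ ‖φ‖ := by
  have h := ae_le_eLpNormEssSup (f := φ) (μ := m)
  have hlt : eLpNormEssSup φ m < ∞ := by simpa using Lp.eLpNorm_lt_top φ
  filter_upwards [h] with x hx
  rw [Lp.norm_def, eLpNorm_exponent_top, ← toReal_enorm]
  exact ENNReal.toReal_mono hlt.ne hx

theorem integrable_vectorState (ξ : Lp ℂ 2 m) (φ : Lp ℂ ∞ m) :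
    Integrable (fun x => φ x * ((‖ξ x‖ ^ 2 : ℝ) : ℂ)) m :=
  (integrable_norm_sq ξ).ofReal.bdd_mul (Lp.aestronglyMeasurable φ) (ae_norm_le_norm_top φ)

theorem norm_vectorState_le (ξ : Lp ℂ 2 m) (φ : Lp ℂ ∞ m) :
    ‖vectorState m ξ φ‖ ≤ ‖φ‖ * ‖ξ‖ ^ 2 := by
  rw [norm_sq_eq_integral, ← integral_const_mul]
  refine norm_integral_le_of_norm_le ((integrable_norm_sq ξ).const_mul _) ?_
  filter_upwards [ae_norm_le_norm_top φ] with x hx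
  rw [norm_mul, Complex.norm_real, Real.norm_of_nonneg (by positivity)]
  gcongr

/-- The measure |π(g)ξ|² m is the image under g of |ξ|² m, since squaring the Koopman weight
restores the Radon–Nikodym derivative. -/
theorem vectorState_translate (g : G) (ξ : Lp ℂ 2 m) (φ : Lp ℂ ∞ m) :
    vectorState m (koopmanHom m g ξ) (translate m g φ) = vectorState m ξ φ := by
  have hmap := integral_map (μ := m) (measurable_const_smul (α := X) g).aemeasurable
    (f := fun x => φ (g⁻¹ • x) * ((‖ξ (g⁻¹ • x)‖ ^ 2 : ℝ) : ℂ))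
    (((Lp.stronglyMeasurable φ).measurable.comp (measurable_const_smul g⁻¹)).mul
      (Complex.measurable_ofReal.comp
        (((Lp.stronglyMeasurable ξ).measurable.comp
          (measurable_const_smul g⁻¹)).norm.pow_const 2))).aestronglyMeasurable
  simp only [inv_smul_smul] at hmap
  have hσ := sigmaFinite_map_smul m g
  rw [vectorState, vectorState, ← hmap, ← integral_rnDeriv_smul (QuasiInvariant.map_ac g)]
  refine integral_congr_ae ?_
  filter_upwards [koopmanIsometry_ae m g ξ, (memLp_top_smul m g φ).coeFn_toLp] with x h1 h2
  have h1' : koopmanHom m g ξ x = koopmanFun m g ξ x := h1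
  rw [h1', translate, h2, koopmanFun, norm_mul, mul_pow, Complex.norm_real, Real.norm_eq_abs,
    sq_abs, Real.sq_sqrt ENNReal.toReal_nonneg, density, Complex.real_smul]
  push_cast
  ring

/-- Cauchy–Schwarz applied to ||ξ|² - |η|²| ≤ (|ξ| + |η|) |ξ - η|. The constant 2 bounds the norm of
|ξ| + |η|. -/
theorem norm_vectorState_sub_le (ξ η : Lp ℂ 2 m) (φ : Lp ℂ ∞ m) (hξ : ‖ξ‖ = 1) (hη : ‖η‖ = 1) :
    ‖vectorState m ξ φ - vectorState m η φ‖ ≤ 2 * ‖φ‖ * ‖ξ - η‖ := by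
  have i1 : MemLp (fun x => ‖ξ x‖ + ‖η x‖) 2 m := (Lp.memLp ξ).norm.add (Lp.memLp η).norm
  have i2 : MemLp (fun x => ‖(ξ - η) x‖) 2 m := (Lp.memLp (ξ - η)).norm
  have hi : Integrable (fun x => (‖ξ x‖ + ‖η x‖) * ‖(ξ - η) x‖) m := i1.integrable_mul i2
  have hle : ‖vectorState m ξ φ - vectorState m η φ‖
      ≤ ∫ x, ‖φ‖ * ((‖ξ x‖ + ‖η x‖) * ‖(ξ - η) x‖) ∂m := by
    rw [vectorState, vectorState,
      ← integral_sub (integrable_vectorState ξ φ) (integrable_vectorState η φ)]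
    refine norm_integral_le_of_norm_le (hi.const_mul _) ?_
    filter_upwards [ae_norm_le_norm_top φ, Lp.coeFn_sub ξ η] with x hx hs
    rw [← mul_sub, norm_mul, ← Complex.ofReal_sub, Complex.norm_real, hs, Pi.sub_apply,
      Real.norm_eq_abs, sq_sub_sq, abs_mul, abs_of_nonneg (by positivity : 0 ≤ ‖ξ x‖ + ‖η x‖)]
    gcongr
    exact abs_norm_sub_norm_le _ _
  have hCS : ∫ x, (‖ξ x‖ + ‖η x‖) * ‖(ξ - η) x‖ ∂m ≤ 2 * ‖ξ - η‖ := by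
    have h1 := real_inner_le_norm i1.toLp i2.toLp
    have e1 : inner ℝ i1.toLp i2.toLp = ∫ x, (‖ξ x‖ + ‖η x‖) * ‖(ξ - η) x‖ ∂m := by
      rw [L2.inner_def]
      refine integral_congr_ae ?_
      filter_upwards [i1.coeFn_toLp, i2.coeFn_toLp] with x h1 h2
      rw [h1, h2]
      simp [mul_comm]
    have e2 : ‖i2.toLp‖ = ‖ξ - η‖ := by
      rw [Lp.norm_toLp, eLpNorm_norm, Lp.norm_def]
    have e3 : ‖i1.toLp‖ ≤ 2 := by
      have : i1.toLp = (Lp.memLp ξ).norm.toLp + (Lp.memLp η).norm.toLp := rfl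
      rw [this]
      refine (norm_add_le _ _).trans ?_
      rw [Lp.norm_toLp, Lp.norm_toLp, eLpNorm_norm, eLpNorm_norm, ← Lp.norm_def, ← Lp.norm_def,
        hξ, hη]
      norm_num
    rw [e1, e2] at h1
    exact h1.trans (by gcongr)
  rw [integral_const_mul] at hle
  calc _ ≤ ‖φ‖ * (2 * ‖ξ - η‖) := hle.trans (by gcongr)
    _ = _ := by ring

/-- Limits of vector states along an ultrafilter are means, invariant under the elements that
asymptotically fix the vectors. -/
theorem hasInvariantMean_of_seq {η : ℕ → Lp ℂ 2 m} (hη : ∀ n, ‖η n‖ = 1) {H : Set G}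
    (hH : ∀ g ∈ H, Tendsto (fun n => ‖koopmanHom m g (η n) - η n‖) atTop (𝓝 0)) :
    HasInvariantMean m H := by
  -- Along an ultrafilter the bounded sequences of values converge for all φ at once, so the limits
  -- are automatically linear in φ.
  let U : Ultrafilter ℕ := Ultrafilter.of atTop
  have hU : (U : Filter ℕ) ≤ atTop := Ultrafilter.of_le atTop
  have hlim : ∀ φ : Lp ℂ ∞ m, ∃ z : ℂ, Tendsto (fun n => vectorState m (η n) φ) U (𝓝 z) := by
    intro φ
    obtain ⟨z, -, hz⟩ := (isCompact_closedBall (0 : ℂ) ‖φ‖).ultrafilter_le_nhds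
      (U.map fun n => vectorState m (η n) φ) (by
        rw [le_principal_iff]
        refine Filter.Eventually.of_forall (f := (U : Filter ℕ)) fun n => ?_
        have h := norm_vectorState_le (η n) φ
        rw [hη] at h
        simpa using h)
    exact ⟨z, hz⟩
  choose M hM using hlim
  refine ⟨{ toFun := M, map_add' := fun φ ψ => ?_, map_smul' := fun c φ => ?_ }, fun φ hφ => ?_,
    ?_, fun g hg φ => ?_⟩
  · refine tendsto_nhds_unique (hM (φ + ψ)) (((hM φ).add (hM ψ)).congr fun n => ?_)
    rw [vectorState, vectorState, vectorState,
      ← integral_add (integrable_vectorState _ φ) (integrable_vectorState _ ψ)]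
    refine integral_congr_ae ?_
    filter_upwards [Lp.coeFn_add φ ψ] with x hx
    rw [hx, Pi.add_apply, add_mul]
  · refine tendsto_nhds_unique (hM (c • φ)) (((hM φ).const_mul c).congr fun n => ?_)
    rw [vectorState, vectorState, ← integral_const_mul]
    refine integral_congr_ae ?_
    filter_upwards [Lp.coeFn_smul c φ] with x hx
    rw [hx, Pi.smul_apply, smul_eq_mul, mul_assoc]
  · open scoped ComplexOrder in
    change 0 ≤ M φ
    refine ge_of_tendsto (hM φ) (Eventually.of_forall fun n => ?_)
    refine integral_nonneg_of_ae ?_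
    filter_upwards [hφ] with x hx
    exact mul_nonneg hx (Complex.zero_le_real.2 (by positivity))
  · change M _ = 1
    refine tendsto_nhds_unique (hM _) (tendsto_const_nhds.congr fun n => ?_)
    have h : vectorState m (η n) (memLp_top_const (1 : ℂ)).toLp = ((‖η n‖ ^ 2 : ℝ) : ℂ) := by
      rw [norm_sq_eq_integral, ← integral_complex_ofReal]
      refine integral_congr_ae ?_
      filter_upwards [(memLp_top_const (1 : ℂ) : MemLp (fun _ : X => (1 : ℂ)) ∞ m).coeFn_toLp]
        with x hx
      rw [hx, one_mul]
    rw [h, hη]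
    simp
  · change M _ = M _
    have h1 : Tendsto (fun n => vectorState m (koopmanHom m g (η n)) (translate m g φ)) U
        (𝓝 (M φ)) := by
      simpa only [vectorState_translate] using hM φ
    refine tendsto_nhds_unique (hM (translate m g φ)) ?_
    have h2 : Tendsto (fun n => vectorState m (η n) (translate m g φ)
        - vectorState m (koopmanHom m g (η n)) (translate m g φ)) U (𝓝 0) := by
      refine squeeze_zero_norm (a := fun n => 2 * ‖translate m g φ‖
        * ‖koopmanHom m g (η n) - η n‖) (fun n => ?_) ?_
      · rw [norm_sub_rev (koopmanHom m g (η n))]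
        exact norm_vectorState_sub_le _ _ _ (hη n) (by rw [LinearIsometryEquiv.norm_map, hη])
      · simpa using ((hH g hg).mono_left hU).const_mul (2 * ‖translate m g φ‖)
    simpa using h2.add h1

end MeanToVectors

/-! ### Spectral values of modulus one for contractions -/

section Spectrum

variable {H : Type*} [NormedAddCommGroup H] [InnerProductSpace ℂ H] [CompleteSpace H]

theorem norm_sub_smul_sq_eq (T : H →L[ℂ] H) {z : ℂ} (hz : ‖z‖ = 1) (v : H) :
    ‖T v - z • v‖ ^ 2 = ‖T v‖ ^ 2 + ‖v‖ ^ 2 - 2 * (inner ℂ (z • v) (T v)).re := by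
  rw [norm_sub_sq (𝕜 := ℂ), norm_smul, hz, one_mul, ← inner_conj_symm (T v) (z • v)]
  simp only [RCLike.re_to_complex, Complex.conj_re]
  ring

/-- Spectral values of modulus one of a contraction are approximate eigenvalues. -/
theorem exists_approx_eigenvector {T : H →L[ℂ] H} (hT : ‖T‖ ≤ 1) {z : ℂ} (hz : ‖z‖ = 1)
    (hmem : z ∈ spectrum ℂ T) {ε : ℝ} (hε : 0 < ε) :
    ∃ ξ : H, ‖ξ‖ = 1 ∧ ‖T ξ - z • ξ‖ < ε := by
  by_contra hcon
  push Not at hcon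
  have hT1 : ∀ ξ, ‖T ξ‖ ≤ ‖ξ‖ := fun ξ => by
    simpa using (T.le_of_opNorm_le hT ξ)
  have hbd : ∀ ξ, ε * ‖ξ‖ ≤ ‖T ξ - z • ξ‖ := by
    intro ξ
    rcases eq_or_ne ξ 0 with rfl | hξ
    · simp
    have hξ' : 0 < ‖ξ‖ := norm_pos_iff.2 hξ
    have h := hcon (((‖ξ‖⁻¹ : ℝ) : ℂ) • ξ) (by
      rw [norm_smul, Complex.norm_real, Real.norm_of_nonneg (by positivity)]
      field_simp)
    rw [map_smul, smul_comm z, ← smul_sub, norm_smul, Complex.norm_real,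
      Real.norm_of_nonneg (by positivity), inv_mul_eq_div, le_div_iff₀ hξ'] at h
    exact h
  rw [spectrum.mem_iff] at hmem
  set S : H →L[ℂ] H := algebraMap ℂ (H →L[ℂ] H) z - T with hS
  have hSa : ∀ ξ, S ξ = z • ξ - T ξ := fun ξ => by
    simp [hS, Algebra.algebraMap_eq_smul_one]
  have hSb : ∀ ξ, ε * ‖ξ‖ ≤ ‖S ξ‖ := fun ξ => by
    rw [hSa, norm_sub_rev]
    exact hbd ξ
  -- A lower bound for S = z - T gives injectivity and closed range, so invertibility only requires
  -- the orthogonal complement of the range to vanish.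
  have hanti : AntilipschitzWith (Real.toNNReal ε⁻¹) S :=
    S.antilipschitz_of_bound fun ξ => by
      rw [Real.coe_toNNReal _ (by positivity), inv_mul_eq_div, le_div_iff₀ hε, mul_comm]
      exact hSb ξ
  have hclosed : IsClosed (LinearMap.range S.toLinearMap : Set H) := by
    rw [LinearMap.coe_range]
    exact hanti.isClosed_range S.uniformContinuous
  refine hmem (ContinuousLinearMap.isUnit_iff_bijective.2 ⟨hanti.injective, ?_⟩)
  rw [← ContinuousLinearMap.coe_coe, ← LinearMap.range_eq_top,
    ← hclosed.submodule_topologicalClosure_eq, Submodule.topologicalClosure_eq_top_iff,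
    Submodule.eq_bot_iff]
  intro v hv
  -- For v orthogonal to the range, orthogonality to the single vector Sv suffices: it gives Re⟨zv,
  -- Tv⟩ = ‖v‖², whence ‖Tv - zv‖² = ‖Tv‖² - ‖v‖² ≤ 0, and the lower bound forces v = 0.
  have h0 : inner ℂ (S v) v = 0 := hv _ ⟨v, rfl⟩
  have h1 : inner ℂ (z • v) v = inner ℂ (T v) v := by
    rw [hSa, inner_sub_left, sub_eq_zero] at h0
    exact h0
  have h2 : (inner ℂ (z • v) (T v)).re = ‖v‖ ^ 2 := by
    have h3 : inner ℂ v (T v) = inner ℂ v (z • v) := by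
      rw [← inner_conj_symm v (T v), ← h1, inner_conj_symm]
    rw [inner_smul_left, h3, ← inner_smul_left, inner_self_eq_norm_sq_to_K, norm_smul, hz, one_mul]
    norm_cast
  have h4 := norm_sub_smul_sq_eq T hz v
  rw [h2] at h4
  have h5 := hT1 v
  have h6 : ‖T v‖ ^ 2 ≤ ‖v‖ ^ 2 := by gcongr
  have h7 : ‖T v - z • v‖ ^ 2 ≤ 0 := by linarith
  have h8 : ‖T v - z • v‖ = 0 := by
    have := sq_nonneg ‖T v - z • v‖
    exact pow_eq_zero_iff two_ne_zero |>.1 (le_antisymm h7 this)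
  have h9 := hbd v
  rw [h8] at h9
  have h10 : ‖v‖ ≤ 0 := nonpos_of_mul_nonpos_right h9 hε
  exact norm_le_zero_iff.1 h10

/-- A contraction with almost fixed unit vectors has spectral radius one. -/
theorem spectralRadius_eq_one_of_seq {T : H →L[ℂ] H} (hT : ‖T‖ ≤ 1) {η : ℕ → H}
    (hη : ∀ n, ‖η n‖ = 1) (h : Tendsto (fun n => ‖T (η n) - η n‖) atTop (𝓝 0)) :
    spectralRadius ℂ T = 1 := by
  have hnt : Nontrivial H := ⟨η 0, 0, fun h0 => by simpa [h0] using hη 0⟩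
  refine le_antisymm ((spectrum.spectralRadius_le_nnnorm T).trans ?_) ?_
  · exact_mod_cast (show ‖T‖₊ ≤ 1 from hT)
  have hmem : (1 : ℂ) ∈ spectrum ℂ T := by
    rw [spectrum.mem_iff, map_one]
    rintro ⟨u, hu⟩
    -- An inverse of 1 - T would bound the unit norm of η_n by a constant times ‖Tη_n - η_n‖, which
    -- tends to 0.
    have hle : ∀ n, 1 ≤ ‖(↑u⁻¹ : H →L[ℂ] H)‖ * ‖T (η n) - η n‖ := by
      intro n
      have e : (↑u⁻¹ : H →L[ℂ] H) ((1 - T) (η n)) = η n := by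
        rw [← hu, ← mul_apply_eq_comp, Units.inv_mul, one_apply_eq_self]
      have h1 := (↑u⁻¹ : H →L[ℂ] H).le_opNorm ((1 - T) (η n))
      rw [e, hη, sub_apply, one_apply_eq_self, norm_sub_rev] at h1
      exact h1
    have h2 := ge_of_tendsto (h.const_mul ‖(↑u⁻¹ : H →L[ℂ] H)‖) (Eventually.of_forall hle)
    rw [mul_zero] at h2
    linarith
  have h1 : ((‖(1 : ℂ)‖₊ : NNReal) : ℝ≥0∞) ≤ spectralRadius ℂ T :=
    le_iSup₂ (f := fun (k : ℂ) (_ : k ∈ spectrum ℂ T) => ((‖k‖₊ : NNReal) : ℝ≥0∞)) 1 hmem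
  simpa using h1

end Spectrum

/-! ### Averaging operators and concentration of orbits -/

section Average

variable {G H : Type*} [Group G] [TopologicalSpace G] [SecondCountableTopology G]
  [MeasurableSpace G] [BorelSpace G] [NormedAddCommGroup H] [InnerProductSpace ℂ H]
  (π : UnitaryRep G H) (μ : Measure G) [IsProbabilityMeasure μ]

namespace UnitaryRep

theorem average_apply (ξ : H) : π.average μ ξ = ∫ g, π.toHom g ξ ∂μ := rfl

theorem norm_average_le_one : ‖π.average μ‖ ≤ 1 := LinearMap.mkContinuous_norm_le _ zero_le_one _

/-- Dominated convergence, with the constant 2 dominating the displacement of a unit vector. -/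
theorem tendsto_average_sub {η : ℕ → H} (hη : ∀ n, ‖η n‖ = 1)
    (h : ∀ g, Tendsto (fun n => ‖π.toHom g (η n) - η n‖) atTop (𝓝 0)) [CompleteSpace H] :
    Tendsto (fun n => ‖π.average μ (η n) - η n‖) atTop (𝓝 0) := by
  have hlim : Tendsto (fun n => ∫ g, ‖π.toHom g (η n) - η n‖ ∂μ) atTop (𝓝 (∫ _, (0 : ℝ) ∂μ)) := by
    refine tendsto_integral_of_dominated_convergence (fun _ => 2)
      (fun n => ((π.continuous_orbit (η n)).sub continuous_const).norm.aestronglyMeasurable)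
      (integrable_const _) (fun n => Eventually.of_forall fun g => ?_) (Eventually.of_forall h)
    rw [norm_norm]
    refine (norm_sub_le _ _).trans ?_
    rw [LinearIsometryEquiv.norm_map, hη]
    norm_num
  rw [integral_zero] at hlim
  refine squeeze_zero (fun _ => norm_nonneg _) (fun n => ?_) hlim
  have e : π.average μ (η n) - η n = ∫ g, (π.toHom g (η n) - η n) ∂μ := by
    rw [integral_sub (π.integrable_orbit μ _) (integrable_const _), average_apply]
    simp
  rw [e]
  exact norm_integral_le_integral_norm _

/-- Expand the square and use that each π(g) is isometric. The mean-square distance from the orbit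
to `ζ` then depends on μ only through one matrix coefficient of π(μ), so near-equality in ‖π(μ)ξ‖ ≤
‖ξ‖ concentrates the orbit. -/
theorem integral_norm_orbit_sub_sq [CompleteSpace H] (ξ ζ : H) :
    ∫ g, ‖π.toHom g ξ - ζ‖ ^ 2 ∂μ
      = ‖ξ‖ ^ 2 + ‖ζ‖ ^ 2 - 2 * (inner ℂ ζ (π.average μ ξ)).re := by
  have hi : Integrable (fun g => inner ℂ ζ (π.toHom g ξ)) μ :=
    (π.integrable_orbit μ ξ).const_inner ζ
  have e : ∀ g, ‖π.toHom g ξ - ζ‖ ^ 2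
      = (‖ξ‖ ^ 2 + ‖ζ‖ ^ 2) - 2 * (inner ℂ ζ (π.toHom g ξ)).re := by
    intro g
    rw [norm_sub_sq (𝕜 := ℂ), LinearIsometryEquiv.norm_map, ← inner_conj_symm (π.toHom g ξ) ζ]
    simp only [RCLike.re_to_complex, Complex.conj_re]
    ring
  simp only [e]
  have hre : ∫ g, (inner ℂ ζ (π.toHom g ξ)).re ∂μ = (inner ℂ ζ (π.average μ ξ)).re := by
    rw [average_apply, ← integral_inner (π.integrable_orbit μ ξ) ζ]
    exact integral_re hi
  have hi' : Integrable (fun g => (inner ℂ ζ (π.toHom g ξ)).re) μ := hi.re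
  rw [integral_sub (integrable_const _) (hi'.const_mul 2), integral_const_mul, hre]
  simp

/-- Convergence of the integrals gives convergence in measure, hence almost everywhere along a
subsequence. -/
theorem exists_seq_tendsto_ae_orbit_sub [CompleteSpace H] {ξ ζ : ℕ → H}
    (h : Tendsto (fun n => ∫ g, ‖π.toHom g (ξ n) - ζ n‖ ^ 2 ∂μ) atTop (𝓝 0)) :
    ∃ ns : ℕ → ℕ, StrictMono ns ∧ ∀ᵐ g ∂μ,
      Tendsto (fun n => ‖π.toHom g (ξ (ns n)) - ζ (ns n)‖) atTop (𝓝 0) := by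
  have hc : ∀ n, Continuous fun g => ‖π.toHom g (ξ n) - ζ n‖ ^ 2 := fun n =>
    ((π.continuous_orbit (ξ n)).sub continuous_const).norm.pow 2
  have hi : ∀ n, Integrable (fun g => ‖π.toHom g (ξ n) - ζ n‖ ^ 2) μ := fun n => by
    refine Integrable.of_bound (hc n).aestronglyMeasurable ((‖ξ n‖ + ‖ζ n‖) ^ 2)
      (Eventually.of_forall fun g => ?_)
    rw [norm_pow, norm_norm]
    gcongr
    refine (norm_sub_le _ _).trans ?_
    rw [LinearIsometryEquiv.norm_map]
  have hm : TendstoInMeasure μ (fun n g => ‖π.toHom g (ξ n) - ζ n‖ ^ 2) atTop fun _ => (0 : ℝ) := by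
    refine tendstoInMeasure_of_tendsto_eLpNorm (p := 1) one_ne_zero
      (fun n => (hc n).aestronglyMeasurable) aestronglyMeasurable_const ?_
    have h2 := ENNReal.tendsto_ofReal h
    rw [ENNReal.ofReal_zero] at h2
    refine h2.congr fun n => ?_
    rw [eLpNorm_one_eq_lintegral_enorm,
      ofReal_integral_eq_lintegral_ofReal (hi n) (Eventually.of_forall fun g => by positivity)]
    refine lintegral_congr fun g => ?_
    rw [Pi.sub_apply, sub_zero, Real.enorm_of_nonneg (by positivity)]
  obtain ⟨ns, hns, hae⟩ := hm.exists_seq_tendsto_ae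
  refine ⟨ns, hns, hae.mono fun g hg => ?_⟩
  have h2 := hg.sqrt
  simpa using h2

end UnitaryRep

end Average

/-! ### Adapted measures and dense subgroups -/

section Support

variable {G : Type*} [Group G] [TopologicalSpace G] [MeasurableSpace G]

theorem isStronglyAdapted_of_support_eq_univ {μ : Measure G} (h : μ.support = Set.univ) :
    IsStronglyAdapted μ := by
  rintro L - hL g hsub
  refine hL (eq_top_iff.2 fun x _ => ?_)
  obtain ⟨y, hy, hxy⟩ := hsub (by rw [h]; trivial : g * x ∈ μ.support)
  rwa [mul_left_cancel hxy] at hy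

theorem isAdapted_of_support_eq_univ {μ : Measure G} (h : μ.support = Set.univ) :
    IsAdapted μ := by
  rw [IsAdapted, h, Subgroup.closure_univ]
  exact dense_univ

/-- The closure of `H` is a closed subgroup of full measure, so it contains the support and hence
the dense subgroup generated by it. `H` itself need not be measurable. -/
theorem IsAdapted.dense_of_ae_mem [IsTopologicalGroup G] {μ : Measure G} (hμ : IsAdapted μ)
    {H : Subgroup G} (hH : ∀ᵐ g ∂μ, g ∈ H) : Dense (H : Set G) := by
  have hsub : μ.support ⊆ H.topologicalClosure := by
    refine Measure.support_subset_of_isClosed H.isClosed_topologicalClosure ?_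
    filter_upwards [hH] with g hg using H.le_topologicalClosure hg
  have h1 : Subgroup.closure μ.support ≤ H.topologicalClosure :=
    (Subgroup.closure_le _).2 hsub
  have h2 : Dense (H.topologicalClosure : Set G) := hμ.mono h1
  rw [Subgroup.topologicalClosure_coe] at h2
  exact dense_closure.1 h2

/-- The closed coset a·cl(H) has full measure and so contains the support; strong adaptedness then
excludes cl(H) ≠ G. -/
theorem IsStronglyAdapted.dense_of_ae_mem [IsTopologicalGroup G] {μ : Measure G}
    (hμ : IsStronglyAdapted μ) {H : Subgroup G} {a : G} (hH : ∀ᵐ g ∂μ, a⁻¹ * g ∈ H) :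
    Dense (H : Set G) := by
  have hc : IsClosed ((fun h => a * h) '' (H.topologicalClosure : Set G)) :=
    (Homeomorph.mulLeft a).isClosedMap _ H.isClosed_topologicalClosure
  have hsub : μ.support ⊆ (fun h => a * h) '' (H.topologicalClosure : Set G) := by
    refine Measure.support_subset_of_isClosed hc ?_
    filter_upwards [hH] with g hg
    exact ⟨a⁻¹ * g, H.le_topologicalClosure hg, mul_inv_cancel_left a g⟩
  have htop : H.topologicalClosure = ⊤ := by
    by_contra hne
    exact hμ _ H.isClosed_topologicalClosure hne a hsub
  rw [dense_iff_closure_eq, ← Subgroup.topologicalClosure_coe, htop]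
  rfl

/-- A probability measure equivalent to Haar measure inherits its full support. -/
theorem exists_isProbabilityMeasure_support_eq_univ [IsTopologicalGroup G]
    [LocallyCompactSpace G] [SecondCountableTopology G] [BorelSpace G] :
    ∃ μ : Measure G, IsProbabilityMeasure μ ∧ μ.support = Set.univ := by
  refine ⟨(Measure.haar : Measure G).toFinite, inferInstance, ?_⟩
  rw [← Set.univ_subset_iff, ← Measure.support_eq_univ (μ := (Measure.haar : Measure G))]
  exact (absolutelyContinuous_toFinite _).support_mono

end Support

/-! ### Moduli of vectors and asymptotic stabilizers -/

section Modulus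

variable {G X : Type*} [Group G] [MeasurableSpace G] [MulAction G X] [MeasurableSpace X]
  [MeasurableSMul₂ G X] {m : Measure X}

theorem lipschitzWith_ofReal_norm : LipschitzWith 1 fun z : ℂ => ((‖z‖ : ℝ) : ℂ) :=
  LipschitzWith.of_dist_le_mul fun z w => by
    rw [NNReal.coe_one, one_mul, Complex.dist_of_im_eq (by simp), Complex.ofReal_re,
      Complex.ofReal_re, dist_eq_norm z w, Real.dist_eq]
    exact abs_norm_sub_norm_le z w

/-- The modulus of a vector of `L²`. -/
noncomputable def modulus (ξ : Lp ℂ 2 m) : Lp ℂ 2 m :=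
  lipschitzWith_ofReal_norm.compLp (by simp) ξ

theorem modulus_ae (ξ : Lp ℂ 2 m) : modulus ξ =ᵐ[m] fun x => ((‖ξ x‖ : ℝ) : ℂ) :=
  lipschitzWith_ofReal_norm.coeFn_compLp (by simp) ξ

theorem norm_modulus (ξ : Lp ℂ 2 m) : ‖modulus ξ‖ = ‖ξ‖ := by
  refine le_antisymm (Lp.norm_le_norm_of_ae_le ?_) (Lp.norm_le_norm_of_ae_le ?_) <;>
  · filter_upwards [modulus_ae ξ] with x hx
    rw [hx]
    simp

theorem norm_modulus_sub_le (ξ ζ : Lp ℂ 2 m) : ‖modulus ξ - modulus ζ‖ ≤ ‖ξ - ζ‖ := by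
  have h := lipschitzWith_ofReal_norm.norm_compLp_sub_le (by simp) ξ ζ
  rwa [NNReal.coe_one, one_mul] at h

theorem modulus_smul {z : ℂ} (hz : ‖z‖ = 1) (ξ : Lp ℂ 2 m) : modulus (z • ξ) = modulus ξ := by
  ext1
  filter_upwards [modulus_ae (z • ξ), modulus_ae ξ, Lp.coeFn_smul z ξ] with x h1 h2 h3
  rw [h1, h2, h3, Pi.smul_apply, norm_smul, hz, one_mul]

/-- The Koopman weight is nonnegative. This lets a unimodular approximate eigenvalue be removed by
taking moduli, a device peculiar to Koopman-type representations. -/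
theorem koopmanHom_modulus [SigmaFinite m] [QuasiInvariant G m] (g : G) (ξ : Lp ℂ 2 m) :
    koopmanHom m g (modulus ξ) = modulus (koopmanHom m g ξ) := by
  ext1
  refine (koopmanIsometry_ae m g (modulus ξ)).trans ?_
  filter_upwards [modulus_ae (koopmanHom m g ξ), koopmanIsometry_ae m g ξ,
    ae_smul m g⁻¹ (modulus_ae ξ)] with x h1 h2 h3
  have h2' : koopmanHom m g ξ x = koopmanFun m g ξ x := h2
  rw [h1, h2', koopmanFun, h3, koopmanFun, norm_mul, Complex.norm_real,
    Real.norm_of_nonneg (Real.sqrt_nonneg _), Complex.ofReal_mul]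

/-- The elements that asymptotically fix a sequence of vectors. -/
noncomputable def asymptoticStabilizer (G : Type*) [Group G] [MeasurableSpace G] [MulAction G X]
    [MeasurableSMul₂ G X] [SigmaFinite m] [QuasiInvariant G m] (η : ℕ → Lp ℂ 2 m) :
    Subgroup G where
  carrier := {g | Tendsto (fun n => ‖koopmanHom m g (η n) - η n‖) atTop (𝓝 0)}
  one_mem' := by simp
  mul_mem' {a b} ha hb := by
    have h := ha.add hb
    rw [add_zero] at h
    refine squeeze_zero (fun _ => norm_nonneg _) (fun n => ?_) h
    have e : koopmanHom m (a * b) (η n) - η n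
        = koopmanHom m a (koopmanHom m b (η n) - η n) + (koopmanHom m a (η n) - η n) := by
      rw [map_mul, map_sub, sub_add_sub_cancel]
      rfl
    rw [e]
    refine (norm_add_le _ _).trans ?_
    rw [LinearIsometryEquiv.norm_map, add_comm]
  inv_mem' {a} ha := by
    refine Tendsto.congr (fun n => ?_) ha
    have e : koopmanHom m a (koopmanHom m a⁻¹ (η n) - η n) = η n - koopmanHom m a (η n) := by
      rw [map_sub, map_inv]
      congr 1
      exact (koopmanHom m a).apply_symm_apply (η n)
    rw [← (koopmanHom m a).norm_map (koopmanHom m a⁻¹ (η n) - η n), e, norm_sub_rev]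

theorem mem_asymptoticStabilizer [SigmaFinite m] [QuasiInvariant G m] {η : ℕ → Lp ℂ 2 m} {g : G} :
    g ∈ asymptoticStabilizer G η
      ↔ Tendsto (fun n => ‖koopmanHom m g (η n) - η n‖) atTop (𝓝 0) := Iff.rfl

end Modulus

/-! ### The implications back to the absence of a spectral gap -/

section Main

variable {G X : Type*} [Group G] [TopologicalSpace G] [IsTopologicalGroup G]
  [LocallyCompactSpace G] [SecondCountableTopology G] [T2Space G]
  [MeasurableSpace G] [BorelSpace G] [MulAction G X] [MeasurableSpace X]
  [MeasurableSMul₂ G X] {m : Measure X} [SigmaFinite m] [QuasiInvariant G m]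

/-- The given vectors need not be almost invariant under all of G. The detour through a mean
replaces them by new vectors that are almost invariant on compact sets. -/
theorem not_hasSpectralGapProperty_of_dense {η : ℕ → Lp ℂ 2 m} (hη : ∀ n, ‖η n‖ = 1)
    (h : Dense (asymptoticStabilizer G η : Set G)) :
    ¬ (koopmanRep G m).HasSpectralGapProperty :=
  (hasInvariantMean_of_seq hη fun _ hg => hg).not_hasSpectralGapProperty h

theorem not_hasSpectralGapProperty_of_norm_average {μ : Measure G} [IsProbabilityMeasure μ]
    (hμ : IsStronglyAdapted μ) (h : ‖(koopmanRep G m).average μ‖ = 1) :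
    ¬ (koopmanRep G m).HasSpectralGapProperty := by
  set T := (koopmanRep G m).average μ with hT
  have key : ∀ n : ℕ, ∃ ξ : Lp ℂ 2 m, ‖ξ‖ = 1 ∧ 1 - 1 / ((n : ℝ) + 1) ≤ ‖T ξ‖ := by
    intro n
    obtain ⟨x, hx, hlt⟩ := T.exists_lt_apply_of_lt_opNorm (r := 1 - 1 / ((n : ℝ) + 1))
      (by rw [h]; linarith [(by positivity : 0 < 1 / ((n : ℝ) + 1))])
    have h0 : 0 ≤ 1 - 1 / ((n : ℝ) + 1) := by
      rw [sub_nonneg, div_le_one (by positivity)]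
      linarith [(Nat.cast_nonneg n : (0 : ℝ) ≤ n)]
    have hx0 : x ≠ 0 := by
      rintro rfl
      simp only [map_zero, norm_zero] at hlt
      linarith
    have hx' : 0 < ‖x‖ := norm_pos_iff.2 hx0
    refine ⟨((‖x‖⁻¹ : ℝ) : ℂ) • x, ?_, ?_⟩
    · rw [norm_smul, Complex.norm_real, Real.norm_of_nonneg (by positivity)]
      field_simp
    · rw [map_smul, norm_smul, Complex.norm_real, Real.norm_of_nonneg (by positivity)]
      refine hlt.le.trans (le_mul_of_one_le_left (norm_nonneg _) ?_)
      exact (one_le_inv₀ hx').2 hx.le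
  choose ξ hξ hTξ using key
  -- With ζ = Tξ the mean-square distance equals 1 - ‖Tξ‖², at most 2/(n+1) by the choice of ξ_n.
  have hlim : Tendsto (fun n => ∫ g, ‖(koopmanRep G m).toHom g (ξ n) - T (ξ n)‖ ^ 2 ∂μ) atTop
      (𝓝 0) := by
    have h1 : Tendsto (fun n : ℕ => 2 * (1 / ((n : ℝ) + 1))) atTop (𝓝 0) := by
      simpa using (tendsto_one_div_add_atTop_nhds_zero_nat (𝕜 := ℝ)).const_mul 2
    refine squeeze_zero (fun n => integral_nonneg fun g => by positivity) (fun n => ?_) h1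
    rw [UnitaryRep.integral_norm_orbit_sub_sq, ← hT, inner_self_eq_norm_sq_to_K, hξ]
    have e : (((‖T (ξ n)‖ : ℝ) : ℂ) ^ 2).re = ‖T (ξ n)‖ ^ 2 := by norm_cast
    have e' : ((RCLike.ofReal ‖T (ξ n)‖ : ℂ) ^ 2).re = ‖T (ξ n)‖ ^ 2 := e
    rw [e']
    have := hTξ n
    have h0 : 0 ≤ 1 - 1 / ((n : ℝ) + 1) := by
      rw [sub_nonneg, div_le_one (by positivity)]
      linarith [(Nat.cast_nonneg n : (0 : ℝ) ≤ n)]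
    nlinarith [sq_nonneg (1 / ((n : ℝ) + 1))]
  obtain ⟨ns, -, hae⟩ := (koopmanRep G m).exists_seq_tendsto_ae_orbit_sub μ hlim
  -- The orbit vectors at `a` and at almost every g approach the same vectors Tξ_n, so a⁻¹g
  -- asymptotically fixes the sequence. This places g in a coset, which is where strong adaptedness
  -- enters.
  obtain ⟨a, ha⟩ := hae.exists
  refine not_hasSpectralGapProperty_of_dense (η := fun n => modulus (ξ (ns n)))
    (fun n => by rw [norm_modulus, hξ]) (hμ.dense_of_ae_mem (a := a) ?_)
  filter_upwards [hae] with g hg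
  have h2 := hg.add ha
  rw [add_zero] at h2
  refine mem_asymptoticStabilizer.2 (squeeze_zero (fun _ => norm_nonneg _) (fun n => ?_) h2)
  rw [koopmanHom_modulus]
  refine (norm_modulus_sub_le _ _).trans ?_
  have e : koopmanHom m a (koopmanHom m (a⁻¹ * g) (ξ (ns n)) - ξ (ns n))
      = koopmanHom m g (ξ (ns n)) - koopmanHom m a (ξ (ns n)) := by
    have := map_mul (koopmanHom (G := G) m) a (a⁻¹ * g)
    rw [mul_inv_cancel_left] at this
    rw [map_sub, this]
    rfl
  rw [← (koopmanHom m a).norm_map, e, ← sub_sub_sub_cancel_right _ _ (T (ξ (ns n)))]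
  exact norm_sub_le _ _

theorem not_hasSpectralGapProperty_of_spectralRadius_average {μ : Measure G}
    [IsProbabilityMeasure μ] (hμ : IsAdapted μ)
    (h : spectralRadius ℂ ((koopmanRep G m).average μ) = 1) :
    ¬ (koopmanRep G m).HasSpectralGapProperty := by
  set T := (koopmanRep G m).average μ with hT
  -- On the zero space the spectral radius is 0. Nontriviality makes the spectrum nonempty, so by
  -- compactness the radius is attained at some `z`, of modulus one.
  have hnt : Nontrivial (Lp ℂ 2 m) := by
    by_contra hs
    rw [not_nontrivial_iff_subsingleton] at hs
    have : T = 0 := Subsingleton.elim _ _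
    rw [this, spectrum.spectralRadius_zero] at h
    exact zero_ne_one h
  obtain ⟨z, hz, hzr⟩ := spectrum.exists_nnnorm_eq_spectralRadius T
  have hz1 : ‖z‖ = 1 := by
    rw [h] at hzr
    have : ‖z‖₊ = 1 := by exact_mod_cast hzr
    rw [← coe_nnnorm, this, NNReal.coe_one]
  have key : ∀ n : ℕ, ∃ ξ : Lp ℂ 2 m, ‖ξ‖ = 1 ∧ ‖T ξ - z • ξ‖ < 1 / ((n : ℝ) + 1) := fun n =>
    exists_approx_eigenvector ((koopmanRep G m).norm_average_le_one μ) hz1 hz (by positivity)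
  choose ξ hξ hTξ using key
  have hzξ : ∀ n, ‖z • ξ n‖ = 1 := fun n => by rw [norm_smul, hz1, hξ, one_mul]
  -- With ζ = zξ the mean-square distance is 2 - 2 Re⟨zξ, Tξ⟩, and Tξ lies within 1/(n+1) of the
  -- unit vector zξ.
  have hlim : Tendsto (fun n => ∫ g, ‖(koopmanRep G m).toHom g (ξ n) - z • ξ n‖ ^ 2 ∂μ) atTop
      (𝓝 0) := by
    have h1 : Tendsto (fun n : ℕ => 2 * (1 / ((n : ℝ) + 1))) atTop (𝓝 0) := by
      simpa using (tendsto_one_div_add_atTop_nhds_zero_nat (𝕜 := ℝ)).const_mul 2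
    refine squeeze_zero (fun n => integral_nonneg fun g => by positivity) (fun n => ?_) h1
    rw [UnitaryRep.integral_norm_orbit_sub_sq, ← hT, hzξ, hξ]
    have e : inner ℂ (z • ξ n) (T (ξ n)) = 1 + inner ℂ (z • ξ n) (T (ξ n) - z • ξ n) := by
      rw [inner_sub_right, inner_self_eq_norm_sq_to_K, hzξ]
      simp
    have h2 : ‖inner ℂ (z • ξ n) (T (ξ n) - z • ξ n)‖ ≤ 1 / ((n : ℝ) + 1) := by
      refine (norm_inner_le_norm _ _).trans ?_
      rw [hzξ, one_mul]
      exact (hTξ n).le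
    have h3 := neg_le_of_abs_le ((Complex.abs_re_le_norm _).trans h2)
    rw [e, Complex.add_re, Complex.one_re]
    linarith
  obtain ⟨ns, -, hae⟩ := (koopmanRep G m).exists_seq_tendsto_ae_orbit_sub μ hlim
  refine not_hasSpectralGapProperty_of_dense (η := fun n => modulus (ξ (ns n)))
    (fun n => by rw [norm_modulus, hξ]) (hμ.dense_of_ae_mem ?_)
  filter_upwards [hae] with g hg
  refine mem_asymptoticStabilizer.2 (squeeze_zero (fun _ => norm_nonneg _) (fun n => ?_) hg)
  -- As |zξ| = |ξ|, closeness of π(g)ξ to zξ becomes almost invariance of |ξ|; no coset appears, so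
  -- adaptedness suffices.
  rw [koopmanHom_modulus, ← modulus_smul hz1 (ξ (ns n))]
  exact norm_modulus_sub_le _ _

end Main

end CoamenableAction

theorem theorem5p7 {G X : Type*} [Group G] [TopologicalSpace G] [IsTopologicalGroup G]
    [LocallyCompactSpace G] [SecondCountableTopology G] [T2Space G]
    [MeasurableSpace G] [BorelSpace G] [MulAction G X] [MeasurableSpace X]
    [MeasurableSMul₂ G X] (m : MeasureTheory.Measure X) [MeasureTheory.SigmaFinite m]
    [CoamenableAction.QuasiInvariant G m] :
    List.TFAE [
      CoamenableAction.IsCoamenable G m,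
      ¬ (CoamenableAction.koopmanRep G m).HasSpectralGapProperty,
      ∀ (μ : MeasureTheory.Measure G) [MeasureTheory.IsProbabilityMeasure μ],
        spectralRadius ℂ ((CoamenableAction.koopmanRep G m).average μ) = 1,
      ∃ (μ : MeasureTheory.Measure G) (_ : MeasureTheory.IsProbabilityMeasure μ),
        CoamenableAction.IsStronglyAdapted μ ∧
          ‖(CoamenableAction.koopmanRep G m).average μ‖ = 1,
      ∃ (μ : MeasureTheory.Measure G) (_ : MeasureTheory.IsProbabilityMeasure μ),
        CoamenableAction.IsAdapted μ ∧
          spectralRadius ℂ ((CoamenableAction.koopmanRep G m).average μ) = 1] := by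
  open CoamenableAction in
  tfae_have 1 → 2 := fun h =>
    ((isCoamenable_iff_hasInvariantMean_univ m).1 h).not_hasSpectralGapProperty dense_univ
  tfae_have 2 → 1 := fun h => by
    obtain ⟨η, hη, hlim⟩ := (koopmanRep G m).exists_almost_invariant_seq h
    exact (isCoamenable_iff_hasInvariantMean_univ m).2
      (hasInvariantMean_of_seq hη fun g _ => hlim g)
  tfae_have 2 → 3 := fun h μ _ => by
    obtain ⟨η, hη, hlim⟩ := (koopmanRep G m).exists_almost_invariant_seq h
    exact spectralRadius_eq_one_of_seq ((koopmanRep G m).norm_average_le_one μ) hη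
      ((koopmanRep G m).tendsto_average_sub μ hη hlim)
  tfae_have 3 → 5 := fun h => by
    obtain ⟨μ, hμ, hs⟩ := exists_isProbabilityMeasure_support_eq_univ (G := G)
    exact ⟨μ, hμ, isAdapted_of_support_eq_univ hs, h μ⟩
  tfae_have 3 → 4 := fun h => by
    obtain ⟨μ, hμ, hs⟩ := exists_isProbabilityMeasure_support_eq_univ (G := G)
    refine ⟨μ, hμ, isStronglyAdapted_of_support_eq_univ hs,
      le_antisymm ((koopmanRep G m).norm_average_le_one μ) ?_⟩
    -- The bound of the spectral radius by the norm is applied in an operator algebra whose identity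
    -- has norm 1, so the zero space must be excluded.
    have hnt : Nontrivial (MeasureTheory.Lp ℂ 2 m) := by
      by_contra hs
      rw [not_nontrivial_iff_subsingleton] at hs
      have h0 := h μ
      rw [Subsingleton.elim ((koopmanRep G m).average μ) 0, spectrum.spectralRadius_zero] at h0
      exact zero_ne_one h0
    have h1 := spectrum.spectralRadius_le_nnnorm (𝕜 := ℂ) ((koopmanRep G m).average μ)
    rw [h μ] at h1
    exact_mod_cast h1
  tfae_have 4 → 2 := fun ⟨μ, _, hμ, h⟩ => not_hasSpectralGapProperty_of_norm_average hμ h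
  tfae_have 5 → 2 := fun ⟨μ, _, hμ, h⟩ =>
    not_hasSpectralGapProperty_of_spectralRadius_average hμ h
  tfae_finish
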